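/- Let $\mathfrak g$ be one of the basic Lie superalgebras $psl(2|2)$, $spo(2|2r)$ with $r\ge 3$, $D(2,1;\frac mn)$ with $m,n$ coprime positive integers, $F(4)$, with highest root $\theta$ of the minimal gradation and invariant form normalized by $(\theta|\theta)=2$. Let $\mathfrak g^\natural=\bigoplus_i\mathfrak g^\natural_i$ be the centralizer of the corresponding $sl(2)$, equal to $sl(2)$, $so(2r)$, $sl(2)\oplus sl(2)$, $so(7)$ respectively, decomposed into simple ideals, with Cartan subalgebra $\mathfrak h^\natural$, root system $\Delta^\natural$, the standard positive roots $\Delta^\natural_+$ and highest roots $\theta^\natural_i$. In orthogonal coordinates these data are: - $psl(2|2)$: $\Delta^\natural_+=\{2\epsilon\}$, $(\epsilon|\epsilon)=-\frac12$ (where $2\epsilon=\delta_1-\delta_2$); weights of $\mathfrak g_{-1/2}$: $\pm\epsilon$; $\rho_R=\omega^1_1=\epsilon$; $h^\vee=0$, $p(k)=k(k+1)$; - $spo(2|2r)$: $\Delta^\natural_+=\{\epsilon_a\pm\epsilon_b: a<b\}$, $(\epsilon_a|\epsilon_a)=-\frac12$; weights of $\mathfrak g_{-1/2}$: $\pm\epsilon_a$;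 $\rho_R=\omega^1_r=\frac12\sum_a\epsilon_a$ or $\rho_R=\omega^1_{r-1}=\omega^1_r-\epsilon_r$; $h^\vee=2-r$, $p(k)=(k+\frac12)(k+\frac{3-r}2)$; - $D(2,1;\frac mn)$: $\Delta^\natural_+=\{2\epsilon_2,2\epsilon_3\}$, $(\epsilon_2|\epsilon_2)=-\frac n{2(m+n)}$, $(\epsilon_3|\epsilon_3)=-\frac m{2(m+n)}$; weights of $\mathfrak g_{-1/2}$: $\pm\epsilon_2\pm\epsilon_3$; $\rho_R=\omega^1_1=\epsilon_2$ or $\rho_R=\omega^2_1=\epsilon_3$; $h^\vee=0$, $p(k)=(k+\frac m{m+n})(k+\frac n{m+n})$; - $F(4)$: $\Delta^\natural_+=\{\epsilon_a\pm\epsilon_b:a<b\}\cup\{\epsilon_a\}$, $1\le a,b\le3$, $(\epsilon_a|\epsilon_a)=-\frac23$; weights of $\mathfrak g_{-1/2}$: $\frac12(\pm\epsilon_1\pm\epsilon_2\pm\epsilon_3)$; $\rho_R=\omega^1_1=\epsilon_1$; $h^\vee=-2$, $p(k)=(k+\frac23)(k-\frac23)$. Put $M_i(k)=\frac{2k}{(\theta^\natural_i|\theta^\natural_i)}-1$,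 and let $k\in\mathbb R$ be such that all $M_i(k)$ are non-negative integers (this holds for every $k$ in the unitary range of the minimal $W$-algebra $W^{\min}_k(\mathfrak g)$). Fix $\rho_R$ from the list, let $i$ be the index of the simple ideal of which $\rho_R$ is a fundamental weight, and put $h^R=4\rho_R/(\theta^\natural_i|\theta^\natural_i)\in\mathfrak h^\natural$, identifying $\mathfrak h^\natural$ with its dual by the form. Let $\Delta^{NS}_+=\{\alpha\in\Delta^\natural:\alpha(h^R)<0\}\cup\{\alpha\in\Delta^\natural_+:\alpha(h^R)=0\}$, again a positive system. Let $P^k_+(R)$ (resp. $P^k_+(NS)$) be the set of weights $\nu$ of $\mathfrak h^\natural$ that are dominant integral for $\Delta^\natural_+$ (resp. $\Delta^{NS}_+$) and satisfy $\nu(\theta_j^\vee)\le M_j(k)$ for all $j$, where $\theta_j$ is the highest root of $\mathfrak g^\natural_j$ for $\Delta^\natural_+$ (resp. $\Delta^{NS}_+$). Set $$A^{NS}(k,\nu)=\frac{(\nu|\nu+2\rho^{NS})}{2(k+h^\vee)}+\frac{(\xi|\nu)}{k+h^\vee}\bigl((\xi|\nu)-k-1\bigr),$$ where $2\rho^{NS}=\sum_{\alpha\in\Delta^{NS}_+}\alpha$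 and $\xi$ is the highest weight of $\mathfrak g_{-1/2}$ for $\Delta^{NS}_+$, and $$A^{R}(k,\nu)=\frac{(\nu|\nu+2\rho^\natural-2\rho_R)+2(\nu|\eta)(\nu+2\rho^\natural-2\rho_R|\eta)-\frac12p(k)}{2(k+h^\vee)},$$ where $2\rho^\natural=\sum_{\alpha\in\Delta^\natural_+}\alpha$ and $\eta$ is the minimal one, with respect to $\Delta^\natural_+$, among the weights of $\mathfrak g_{-1/2}$ that are positive on $h^R$. Then for every $\nu\in P^k_+(NS)$ the weight $\nu^R=\nu+M_i(k)\rho_R$ lies in $P^k_+(R)$, and $$A^{NS}(k,\nu)+\frac{2}{(\theta^\natural_i|\theta^\natural_i)}(\nu|\rho_R)+\frac{1}{(\theta^\natural_i|\theta^\natural_i)}M_i(k)(\rho_R|\rho_R)=A^R(k,\nu^R).$$ -/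

import Mathlib

/-! Root-theoretic data of the basic Lie superalgebras `psl(2|2)`, `spo(2|2r)`, `D(2,1;m/n)`, `F(4)`
relative to their minimal gradation, and the weight sets and conformal-weight bounds attached to the
minimal `W`-algebra of level `k` in the Neveu-Schwarz and Ramond sectors. -/

noncomputable section

namespace MinimalW

/-- The Lie superalgebras under consideration. In the family `D(2,1;m/n)` the integers `m`, `n` are
positive and coprime; `spo(2|2r)` is taken with `r > 2`, as `spo(2|4) = D(2,1;1)`. -/
inductive Superalgebra : Type
  | psl22 : Superalgebra
  | spo (r : ℕ) (hr : 3 ≤ r) : Superalgebra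
  | D21 (m n : ℕ) (hm : 0 < m) (hn : 0 < n) (hmn : m.Coprime n) : Superalgebra
  | F4 : Superalgebra

/-- The combinatorial data of a pair `(𝔤, θ)`, where `θ` is the highest root of the minimal gradation
and the invariant form is normalized by `(θ|θ) = 2`. The real span of the weights of `𝔥♮` is identified
with `Fin n → ℝ` by means of an orthogonal basis `ε`. (All the weights that are integral for `𝔤♮` lie in
this real span.) It is only used through the explicit values `Superalgebra.data` below. -/
structure RootData where
  /-- rank of `𝔤♮` -/
  n : ℕ
  /-- number of simple ideals of `𝔤♮` -/
  s : ℕ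
  /-- the numbers `(ε_a|ε_a)` -/
  sq : Fin n → ℝ
  /-- the positive roots of the simple ideal `𝔤♮_i` -/
  pos : Fin s → Set (Fin n → ℝ)
  /-- the `𝔥♮`-weights of `𝔤_{-1/2}` -/
  halfWeights : Set (Fin n → ℝ)
  /-- the dual Coxeter number `h^∨` of `𝔤` -/
  hDual : ℝ
  /-- the monic quadratic polynomial `p(k)` in the `λ`-bracket of the odd generators `G^{v}` -/
  p : ℝ → ℝ
  /-- the pairs `(i, ρ_R)`, with `ρ_R = ω^i_j` a fundamental weight of `𝔤♮_i`, that are allowed -/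
  rhoR : Set (Fin s × (Fin n → ℝ))

/-- The basis vector `ε_a`. -/
def e {n : ℕ} (a : Fin n) : Fin n → ℝ := Pi.single a 1

/-- The positive roots `ε_a ± ε_b`, `a < b`, of `so(2r)`. -/
def posD (r : ℕ) : Set (Fin r → ℝ) :=
  {α | ∃ a b : Fin r, a < b ∧ (α = e a + e b ∨ α = e a - e b)}

/-- The positive roots `ε_a ± ε_b`, `a < b`, and `ε_a` of `so(2r+1)`. -/
def posB (r : ℕ) : Set (Fin r → ℝ) :=
  posD r ∪ {α | ∃ a : Fin r, α = e a}

/-- * `psl(2|2)`: `𝔤♮ = sl(2)` with positive root `δ₁ - δ₂ = 2ε`, where `ε = (δ₁ - δ₂)/2` and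
  `(δ_i|δ_j) = -δ_ij`; the weights of `𝔤_{-1/2}` are `±ε` (each of multiplicity two), `ρ_R = ω_1 = ε`.
* `spo(2|2r)`: `𝔤♮ = so(2r)`, `𝔤_{-1/2} = ℂ^{2r}`, `ρ_R = ω_r = (ε_1 + ⋯ + ε_r)/2` or
  `ρ_R = ω_{r-1} = (ε_1 + ⋯ + ε_{r-1} - ε_r)/2`.
* `D(2,1;m/n)`: `𝔤♮ = sl(2) × sl(2)` with positive roots `2ε_2` and `2ε_3` (here `e 0 = ε_2` and
  `e 1 = ε_3`), `𝔤_{-1/2} = ℂ² ⊗ ℂ²`, `ρ_R = ω_1^1 = ε_2` or `ρ_R = ω_1^2 = ε_3`.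
* `F(4)`: `𝔤♮ = so(7)`, `𝔤_{-1/2}` is the spin representation, `ρ_R = ω_1 = ε_1`. -/
def Superalgebra.data : Superalgebra → RootData
  | .psl22 =>
    { n := 1
      s := 1
      sq := fun _ => -1 / 2
      pos := fun _ => {(2 : ℝ) • e 0}
      halfWeights := {e 0, -e 0}
      hDual := 0
      p := fun k => k * (k + 1)
      rhoR := {(0, e 0)} }
  | .spo r hr =>
    { n := r
      s := 1
      sq := fun _ => -1 / 2
      pos := fun _ => posD r
      halfWeights := {η | ∃ a : Fin r, η = e a ∨ η = -e a}
      hDual := 2 - r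
      p := fun k => (k + 1 / 2) * (k + (3 - r) / 2)
      rhoR := {(0, fun _ => 1 / 2),
        (0, (fun _ => 1 / 2) - e ⟨r - 1, by omega⟩)} }
  | .D21 m n _ _ _ =>
    { n := 2
      s := 2
      sq := ![-n / (2 * (m + n)), -m / (2 * (m + n))]
      pos := fun i => {(2 : ℝ) • e i}
      halfWeights := {e 0 + e 1, e 0 - e 1, -e 0 + e 1, -e 0 - e 1}
      hDual := 0
      p := fun k => (k + m / (m + n)) * (k + n / (m + n))
      rhoR := {(0, e 0), (1, e 1)} }
  | .F4 =>
    { n := 3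
      s := 1
      sq := fun _ => -2 / 3
      pos := fun _ => posB 3
      halfWeights := {η | ∀ a, η a = 1 / 2 ∨ η a = -1 / 2}
      hDual := -2
      p := fun k => (k + 2 / 3) * (k - 2 / 3)
      rhoR := {(0, e 0)} }

namespace RootData

variable (R : RootData)

/-- The invariant bilinear form `(·|·)` on weights. -/
def form (μ ν : Fin R.n → ℝ) : ℝ := ∑ a, R.sq a * μ a * ν a

/-- The value `ν(α^∨) = 2(ν|α)/(α|α)` of a weight on the coroot of the root `α`. -/
def onCoroot (ν α : Fin R.n → ℝ) : ℝ := 2 * R.form ν α / R.form α α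

/-- The roots of the simple ideal `𝔤♮_i`. -/
def roots (i : Fin R.s) : Set (Fin R.n → ℝ) := {α | α ∈ R.pos i ∨ -α ∈ R.pos i}

/-- `Δ♮`, the set of roots of `𝔤♮`. -/
def allRoots : Set (Fin R.n → ℝ) := ⋃ i, R.roots i

/-- `Δ♮_+`, the positive roots used in the Ramond sector. -/
def posR : Set (Fin R.n → ℝ) := ⋃ i, R.pos i

/-- `θ` is the highest root of `𝔤♮_i` for the positive system `P`: no positive root can be added. -/
def IsHighestRoot (P : Set (Fin R.n → ℝ)) (i : Fin R.s) (θ : Fin R.n → ℝ) : Prop :=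
  θ ∈ R.roots i ∧ θ ∈ P ∧ ∀ α ∈ P, θ + α ∉ R.roots i

/-- The highest root of `𝔤♮_i` for the positive system `P`. -/
def highestRoot (P : Set (Fin R.n → ℝ)) (i : Fin R.s) : Fin R.n → ℝ :=
  Classical.epsilon (R.IsHighestRoot P i)

/-- `θ♮_i`, the highest root of `𝔤♮_i` for `Δ♮_+`. -/
def theta (i : Fin R.s) : Fin R.n → ℝ := R.highestRoot R.posR i

/-- `M_i(k)`, the level of the affine vertex subalgebra of `𝔤♮_i`. In the four cases:
`-k - 1`; `-2k - 1`; `-(m+n)k/n - 1` and `-(m+n)k/m - 1`; `-3k/2 - 1`. -/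
def M (i : Fin R.s) (k : ℝ) : ℝ := 2 * k / R.form (R.theta i) (R.theta i) - 1

/-- `α(h^R)` for `h^R = 4 ρ_R / (θ♮_i|θ♮_i) ∈ 𝔥♮`, where `𝔥♮` and its dual are identified. -/
def onHR (i : Fin R.s) (ρR α : Fin R.n → ℝ) : ℝ :=
  4 * R.form α ρR / R.form (R.theta i) (R.theta i)

/-- `Δ^{NS}_+`, the positive system used in the Neveu-Schwarz sector. -/
def posNS (i : Fin R.s) (ρR : Fin R.n → ℝ) : Set (Fin R.n → ℝ) :=
  {α | α ∈ R.allRoots ∧ R.onHR i ρR α < 0} ∪ {α | α ∈ R.posR ∧ R.onHR i ρR α = 0}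

/-- The dominant integral weights `ν` for the positive system `P` such that `ν(θ_i^∨) ≤ M_i(k)` for all
`i`, where `θ_i` is the highest root of `𝔤♮_i` for `P`. -/
def levelWeights (P : Set (Fin R.n → ℝ)) (k : ℝ) : Set (Fin R.n → ℝ) :=
  {ν | (∀ α ∈ P, ∃ c : ℕ, R.onCoroot ν α = c) ∧
    ∀ i, R.onCoroot ν (R.highestRoot P i) ≤ R.M i k}

/-- `P^k_+(R)`. -/
def PR (k : ℝ) : Set (Fin R.n → ℝ) := R.levelWeights R.posR k

/-- `P^k_+(NS)`, which depends on the choice of `ρ_R`. -/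
def PNS (i : Fin R.s) (ρR : Fin R.n → ℝ) (k : ℝ) : Set (Fin R.n → ℝ) :=
  R.levelWeights (R.posNS i ρR) k

/-- `2ρ♮` for the positive system `P`: the sum of the roots in the finite set `P`. -/
def twoRho (P : Set (Fin R.n → ℝ)) : Fin R.n → ℝ := ∑ᶠ α ∈ P, α

/-- `ξ` is the highest weight of the `𝔤♮`-module `𝔤_{-1/2}` for the positive system `P`. -/
def IsHighestHalfWeight (P : Set (Fin R.n → ℝ)) (ξ : Fin R.n → ℝ) : Prop :=
  ξ ∈ R.halfWeights ∧ ∀ α ∈ P, ξ + α ∉ R.halfWeights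

/-- The highest weight of `𝔤_{-1/2}` for the positive system `P`. -/
def highestHalfWeight (P : Set (Fin R.n → ℝ)) : Fin R.n → ℝ :=
  Classical.epsilon (R.IsHighestHalfWeight P)

/-- The bound `A^{NS}(k,ν)`, for highest weights with respect to `Δ^{NS}_+`:
`(ν|ν+2ρ^{NS})/(2(k+h^∨)) + (ξ|ν)((ξ|ν) - k - 1)/(k+h^∨)`, where `2ρ^{NS}` is the sum of the roots in
`Δ^{NS}_+` and `ξ` is the highest weight of `𝔤_{-1/2}` for `Δ^{NS}_+`. In the four cases:
* `r/2` for `ν = -r ε`, `ε = (δ₁ - δ₂)/2`;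
* `-(∑_i (m_i² - 2(i-1)m_i) + m_r(2k - m_r + 2))/(4(k-r+2))` for `ν = ∑ m_i ε_i`, `ρ_R = ω_r`;
* `((m₁-m₂)² + 2t(m₂m + m₁n))/(4(m+n)t)` for `k = -mnt/(m+n)` and `ν = -m₁ε_2 + m₂ε_3`, `ρ_R = ω_1^1`
  (or `ν = m₁ε_2 - m₂ε_3`, `ρ_R = ω_1^2`);
* `(m₁(6-3k/2) + m₂(3-3k/2) - 3k m₃/2 + ∑ m_i² - ∑_{i<j} m_i m_j)/(3(3-3k/2))` for
  `ν = -m₁ε_1 + m₂ε_2 + m₃ε_3`. -/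
def ANS (i : Fin R.s) (ρR : Fin R.n → ℝ) (k : ℝ) (ν : Fin R.n → ℝ) : ℝ :=
  let P := R.posNS i ρR
  let ξ := R.highestHalfWeight P
  R.form ν (ν + R.twoRho P) / (2 * (k + R.hDual)) +
    R.form ξ ν / (k + R.hDual) * (R.form ξ ν - k - 1)

/-- The set of weights `η` of `𝔤_{-1/2}` with `η(h^R) > 0`; the odd zero modes `G^{v}_0` with `v` of
weight in this set annihilate Ramond highest weight vectors. Half of the sum of these weights, counted
with multiplicity, is `ρ_R`. -/
def posHalfWeights (i : Fin R.s) (ρR : Fin R.n → ℝ) : Set (Fin R.n → ℝ) :=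
  {η | η ∈ R.halfWeights ∧ 0 < R.onHR i ρR η}

/-- `η` is the minimal positive weight of `𝔤_{-1/2}`, with respect to `Δ♮_+`. -/
def IsMinHalfWeight (i : Fin R.s) (ρR η : Fin R.n → ℝ) : Prop :=
  η ∈ R.posHalfWeights i ρR ∧ ∀ α ∈ R.posR, η - α ∉ R.posHalfWeights i ρR

/-- The minimal positive weight of `𝔤_{-1/2}`. -/
def minHalfWeight (i : Fin R.s) (ρR : Fin R.n → ℝ) : Fin R.n → ℝ :=
  Classical.epsilon (R.IsMinHalfWeight i ρR)

/-- The bound `A^R(k,ν)`: the value of `ℓ` for which the norm of `G^{v}_0 v_{ν,ℓ}` is zero, where `v` has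
weight `-η` with `η` minimal. With `2ρ♮` the sum of the roots in `Δ♮_+`, it is
`((ν|ν+2ρ♮-2ρ_R) + 2(ν|η)(ν+2ρ♮-2ρ_R|η) - p(k)/2) / (2(k+h^∨))`. In the four cases:
* `-(k+1)/4`;
* `(-4 ∑_{i<r} (m_i² + (2(r-i)-1)m_i) - 4k² + 2(r-4)k + r - 3)/(16(k+2-r))` for `ν = ∑ m_i ε_i`;
* `((1+m₁+m₂)² + t(mnt-m-n))/(4(m+n)t)` for `k = -mnt/(m+n)` and `ν = m₁ε_2 + m₂ε_3`;
* `-(9k² + 8m₁² + 8m₁(m₂+m₃+5) + 8m₂² - 8m₂m₃ + 32m₂ + 8m₃² + 8m₃ - 4)/(36(k-2))` for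
  `ν = m₁ε_1 + m₂ε_2 + m₃ε_3`. -/
def AR (i : Fin R.s) (ρR : Fin R.n → ℝ) (k : ℝ) (ν : Fin R.n → ℝ) : ℝ :=
  let σ := R.twoRho R.posR - (2 : ℝ) • ρR
  let η := R.minHalfWeight i ρR
  (R.form ν (ν + σ) + 2 * R.form ν η * R.form (ν + σ) η - R.p k / 2) / (2 * (k + R.hDual))

end RootData

end MinimalW

end

namespace MinimalW

/-! Write M = M_i(k) and call a root long if (α|α) = (θ_i|θ_i). The element h^R takes only the
values 0 and ±2 on roots. A positive root α with α(h^R) = 0 lies in both positive systems, and its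
coroot takes the same value on ν and on ν^R. If α(h^R) = 2, then -α is NS-positive. For α long,
α^∨(ρ_R) = 1, so α^∨(ν^R) = M - (-α)^∨(ν). This is a non-negative integer, because (-α)^∨(ν) is at
most the value of ν on the coroot of the NS-highest root, hence at most M. The case α = θ_i gives
the level bound θ_i^∨(ν^R) ≤ M. The short root of so(7) involved takes the value 2 on ρ_R, and 2M
replaces M.

For the identity, ξ = -η in every case, and 2ρ♮ - 2ρ^NS is a multiple of ρ_R. The terms quadratic in
ν therefore agree, and eliminating M by M = 2k/(θ_i|θ_i) - 1 matches the linear and constant terms,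
p(k) entering the latter. The form is negative definite and h^∨ ≤ 0, so M ≥ 0 forces k + h^∨ < 0 and
denominators may be cleared.

The objects of the statement are given by choice, so `main_of_explicitData` first replaces them by
explicit vectors. Each family then needs an `explicitData_*` lemma (root combinatorics) and a
`spectralFlow_*` lemma (dominance and algebra). For spo(2|2r) both are uniform in r and in the
choice of ρ_R, through an orthonormal family f with f_a · ρ_R = 1/2. -/

theorem epsilon_eq_of_unique {α : Type*} [Nonempty α] {p : α → Prop} {x : α} (hx : p x)
    (h : ∀ y, p y → y = x) : Classical.epsilon p = x :=
  h _ (Classical.epsilon_spec ⟨x, hx⟩)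

/-! ### Reduction to explicit root data. -/

section Generic

variable {n s : ℕ}

/-- The bilinear form with diagonal Gram matrix `sq`. -/
def diagForm (sq : Fin n → ℝ) (μ ν : Fin n → ℝ) : ℝ := ∑ a, sq a * μ a * ν a

/-- `x` is the only element of `P ∩ Q` that cannot be raised inside `Q` by an element of `P`. -/
def IsUniqueMaximal (P Q : Set (Fin n → ℝ)) (x : Fin n → ℝ) : Prop :=
  (x ∈ Q ∧ x ∈ P ∧ ∀ α ∈ P, x + α ∉ Q) ∧ ∀ y ∈ P, y ∈ Q → y ≠ x → ∃ α ∈ P, y + α ∈ Q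

/-- The symmetric closure of a set of positive roots. -/
def symm (P : Set (Fin n → ℝ)) : Set (Fin n → ℝ) := {α | α ∈ P ∨ -α ∈ P}

/-- Explicit values of all the objects attached to root data and a choice of `ρ_R`. -/
structure ExplicitData (sq : Fin n → ℝ) (pos : Fin s → Set (Fin n → ℝ))
    (halfWeights : Set (Fin n → ℝ)) (i : Fin s) (ρ : Fin n → ℝ)
    (P PN : Set (Fin n → ℝ)) (θ θN : Fin s → Fin n → ℝ) (τ τN ξ η : Fin n → ℝ) : Prop where
  iUnion_pos : ⋃ j, pos j = P
  theta : ∀ j, IsUniqueMaximal P (symm (pos j)) (θ j)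
  posNS : ∀ x, (x ∈ symm P ∧ 4 * diagForm sq x ρ / diagForm sq (θ i) (θ i) < 0) ∨
    (x ∈ P ∧ 4 * diagForm sq x ρ / diagForm sq (θ i) (θ i) = 0) ↔ x ∈ PN
  thetaNS : ∀ j, IsUniqueMaximal PN (symm (pos j)) (θN j)
  twoRho : ∑ᶠ α ∈ P, α = τ
  twoRhoNS : ∑ᶠ α ∈ PN, α = τN
  highest_mem : ξ ∈ halfWeights
  highest_add : ∀ α ∈ PN, ξ + α ∉ halfWeights
  highest_unique : ∀ y ∈ halfWeights, y ≠ ξ → ∃ α ∈ PN, y + α ∈ halfWeights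
  min_mem : η ∈ halfWeights ∧ 0 < 4 * diagForm sq η ρ / diagForm sq (θ i) (θ i)
  min_sub : ∀ α ∈ P, η - α ∈ halfWeights →
    4 * diagForm sq (η - α) ρ / diagForm sq (θ i) (θ i) ≤ 0
  min_unique : ∀ y ∈ halfWeights, 0 < 4 * diagForm sq y ρ / diagForm sq (θ i) (θ i) → y ≠ η →
    ∃ α ∈ P, y - α ∈ halfWeights ∧ 0 < 4 * diagForm sq (y - α) ρ / diagForm sq (θ i) (θ i)

theorem highestRoot_eq (R : RootData) {P : Set (Fin R.n → ℝ)} {j : Fin R.s} {θ : Fin R.n → ℝ}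
    (h : IsUniqueMaximal P (symm (R.pos j)) θ) : R.highestRoot P j = θ := by
  refine epsilon_eq_of_unique h.1 fun y hy => ?_
  by_contra hne
  obtain ⟨α, hα, h1⟩ := h.2 y hy.2.1 hy.1 hne
  exact hy.2.2 α hα h1

/-- The spectral flow `ν ↦ ν + M_i ρ_R` preserves dominance and relates the two bounds, everything
being expressed through explicit data. -/
def SpectralFlow (sq : Fin n → ℝ) (i : Fin s) (ρ : Fin n → ℝ) (hDual : ℝ) (p : ℝ → ℝ)
    (P PN : Set (Fin n → ℝ)) (θ θN : Fin s → Fin n → ℝ) (τ τN ξ η : Fin n → ℝ)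
    (k : ℝ) (ν : Fin n → ℝ) : Prop :=
    ∀ M : Fin s → ℕ, (∀ j, 2 * k / diagForm sq (θ j) (θ j) - 1 = M j) →
      (∀ α ∈ PN, ∃ c : ℕ, 2 * diagForm sq ν α / diagForm sq α α = c) →
      (∀ j, 2 * diagForm sq ν (θN j) / diagForm sq (θN j) (θN j) ≤ M j) →
      (∀ α ∈ P, ∃ c : ℕ, 2 * diagForm sq (ν + (M i : ℝ) • ρ) α / diagForm sq α α = c) ∧
      (∀ j, 2 * diagForm sq (ν + (M i : ℝ) • ρ) (θ j) / diagForm sq (θ j) (θ j) ≤ M j) ∧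
      diagForm sq ν (ν + τN) / (2 * (k + hDual)) +
        diagForm sq ξ ν / (k + hDual) * (diagForm sq ξ ν - k - 1)
        + 2 / diagForm sq (θ i) (θ i) * diagForm sq ν ρ
        + 1 / diagForm sq (θ i) (θ i) * M i * diagForm sq ρ ρ =
      (diagForm sq (ν + (M i : ℝ) • ρ) (ν + (M i : ℝ) • ρ + (τ - (2 : ℝ) • ρ)) +
        2 * diagForm sq (ν + (M i : ℝ) • ρ) η *
          diagForm sq (ν + (M i : ℝ) • ρ + (τ - (2 : ℝ) • ρ)) η - p k / 2) /
        (2 * (k + hDual))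

/-- The compatibility of spectral flow with weights and bounds, for one choice of `ρ_R`. -/
def SatisfiesMain (R : RootData) (i : Fin R.s) (ρ : Fin R.n → ℝ) : Prop :=
  ∀ k : ℝ, (∀ j, ∃ N : ℕ, R.M j k = N) → ∀ ν ∈ R.PNS i ρ k,
    ν + R.M i k • ρ ∈ R.PR k ∧
    R.ANS i ρ k ν + 2 / R.form (R.theta i) (R.theta i) * R.form ν ρ
        + 1 / R.form (R.theta i) (R.theta i) * R.M i k * R.form ρ ρ
      = R.AR i ρ k (ν + R.M i k • ρ)

/-- Highest roots, ξ and η are values of `Classical.epsilon`. Existence together with uniqueness of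
a maximal (or minimal) element identifies each with the vector listed in `ExplicitData`. -/
theorem main_of_explicitData (R : RootData) {i : Fin R.s} {ρ : Fin R.n → ℝ}
    {P PN : Set (Fin R.n → ℝ)} {θ θN : Fin R.s → Fin R.n → ℝ} {τ τN ξ η : Fin R.n → ℝ}
    (D : ExplicitData R.sq R.pos R.halfWeights i ρ P PN θ θN τ τN ξ η)
    (k : ℝ) (hk : ∀ j, ∃ N : ℕ, R.M j k = N) (ν : Fin R.n → ℝ) (hν : ν ∈ R.PNS i ρ k)
    (H : SpectralFlow R.sq i ρ R.hDual R.p P PN θ θN τ τN ξ η k ν) :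
    ν + R.M i k • ρ ∈ R.PR k ∧
    R.ANS i ρ k ν + 2 / R.form (R.theta i) (R.theta i) * R.form ν ρ
        + 1 / R.form (R.theta i) (R.theta i) * R.M i k * R.form ρ ρ
      = R.AR i ρ k (ν + R.M i k • ρ) := by
  have hform : R.form = diagForm R.sq := rfl
  have hP : R.posR = P := D.iUnion_pos
  have hθ : ∀ j, R.theta j = θ j := fun j => by
    rw [RootData.theta, hP]; exact highestRoot_eq R (D.theta j)
  have hall : R.allRoots = symm P := by
    ext x
    simp only [← hP, RootData.allRoots, RootData.roots, RootData.posR, symm, Set.mem_iUnion,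
      Set.mem_ofPred_eq, exists_or]
  have hPN : R.posNS i ρ = PN := by
    ext x
    rw [← D.posNS x, RootData.posNS, hall, hP]
    simp only [RootData.onHR, hθ, hform, Set.mem_union, Set.mem_ofPred_eq]
  have hξ : R.highestHalfWeight PN = ξ := by
    refine epsilon_eq_of_unique ⟨D.highest_mem, D.highest_add⟩ fun y hy => ?_
    by_contra hne
    obtain ⟨α, hα, h1⟩ := D.highest_unique y hy.1 hne
    exact hy.2 α hα h1
  have hhalf : ∀ x, x ∈ R.posHalfWeights i ρ ↔
      x ∈ R.halfWeights ∧ 0 < 4 * diagForm R.sq x ρ / diagForm R.sq (θ i) (θ i) := fun x => by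
    simp only [RootData.posHalfWeights, RootData.onHR, hθ, hform, Set.mem_ofPred_eq]
  have hη : R.minHalfWeight i ρ = η := by
    refine epsilon_eq_of_unique ⟨(hhalf _).2 D.min_mem, ?_⟩ fun y hy => ?_
    · intro α hα h1
      rw [hP] at hα
      obtain ⟨h2, h3⟩ := (hhalf _).1 h1
      exact h3.not_ge (D.min_sub α hα h2)
    · by_contra hne
      obtain ⟨h2, h3⟩ := (hhalf _).1 hy.1
      obtain ⟨α, hα, h1⟩ := D.min_unique y h2 h3 hne
      exact hy.2 α (hP ▸ hα) ((hhalf _).2 h1)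
  have hτ : R.twoRho P = τ := D.twoRho
  have hτN : R.twoRho PN = τN := D.twoRhoNS
  choose M hM using hk
  have hM' : ∀ j, 2 * k / diagForm R.sq (θ j) (θ j) - 1 = M j := fun j => by
    rw [← hM, RootData.M, hθ, hform]
  obtain ⟨hν1, hν2⟩ := hν
  rw [hPN] at hν1 hν2
  obtain ⟨h1, h2, h3⟩ := H M hM' hν1 fun j => by
    have := hν2 j
    rwa [highestRoot_eq R (D.thetaNS j), hM] at this
  refine ⟨⟨?_, fun j => ?_⟩, ?_⟩
  · rw [hP, hM]; exact h1
  · rw [hP, highestRoot_eq R (D.theta j), hM, hM]; exact h2 j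
  · simp only [RootData.ANS, RootData.AR]
    rw [hPN, hξ, hP, hτ, hτN, hη, hθ, hM, hform]
    exact h3

/-- The record is taken apart into its fields so that explicit data over a concrete `Fin n → ℝ`
unify with the unfolded `Superalgebra.data`. -/
theorem main_of_explicitData_mk {sq : Fin n → ℝ} {pos : Fin s → Set (Fin n → ℝ)}
    {halfWeights : Set (Fin n → ℝ)} {hDual : ℝ} {p : ℝ → ℝ} {rhoR : Set (Fin s × (Fin n → ℝ))}
    {i : Fin s} {ρ : Fin n → ℝ}
    {P PN : Set (Fin n → ℝ)} {θ θN : Fin s → Fin n → ℝ} {τ τN ξ η : Fin n → ℝ}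
    (D : ExplicitData sq pos halfWeights i ρ P PN θ θN τ τN ξ η)
    (H : ∀ k ν, SpectralFlow sq i ρ hDual p P PN θ θN τ τN ξ η k ν) :
    SatisfiesMain ⟨n, s, sq, pos, halfWeights, hDual, p, rhoR⟩ i ρ :=
  fun k hk ν hν => main_of_explicitData _ D k hk ν hν (H k ν)

end Generic

theorem diagForm_one (sq μ ν : Fin 1 → ℝ) : diagForm sq μ ν = sq 0 * μ 0 * ν 0 := by
  simp [diagForm]

theorem diagForm_two (sq μ ν : Fin 2 → ℝ) :
    diagForm sq μ ν = sq 0 * μ 0 * ν 0 + sq 1 * μ 1 * ν 1 := by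
  simp [diagForm, Fin.sum_univ_two]

theorem diagForm_three (sq μ ν : Fin 3 → ℝ) :
    diagForm sq μ ν = sq 0 * μ 0 * ν 0 + sq 1 * μ 1 * ν 1 + sq 2 * μ 2 * ν 2 := by
  simp [diagForm, Fin.sum_univ_three]

theorem e_one_zero : (e 0 : Fin 1 → ℝ) = ![1] := by
  ext a; fin_cases a; simp [e]

theorem e_two_zero : (e 0 : Fin 2 → ℝ) = ![1, 0] := by
  ext a; fin_cases a <;> simp [e]

theorem e_two_one : (e 1 : Fin 2 → ℝ) = ![0, 1] := by
  ext a; fin_cases a <;> simp [e]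

/-! ### The case psl(2|2). -/

theorem explicitData_psl22 :
    ExplicitData (n := 1) (s := 1) (fun _ => -1 / 2) (fun _ => {(2 : ℝ) • e 0}) {e 0, -e 0} 0 (e 0)
      {![2]} {![-2]} (fun _ => ![2]) (fun _ => ![-2]) ![2] ![-2] ![-1] ![1] := by
  simp only [e_one_zero]
  constructor
  · simp
  · intro j
    simp [IsUniqueMaximal, symm]
    norm_num
  · intro x
    obtain ⟨a, rfl⟩ : ∃ a, x = ![a] := ⟨x 0, by ext j; fin_cases j; rfl⟩
    simp [symm, diagForm_one, neg_eq_iff_eq_neg]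
    constructor
    · rintro (⟨rfl | rfl, h⟩ | ⟨rfl, h⟩)
      · norm_num at h
      · rfl
      · norm_num at h
    · rintro rfl
      norm_num
  · intro j
    simp [IsUniqueMaximal, symm]
    norm_num
  · exact finsum_mem_singleton
  · exact finsum_mem_singleton
  · simp
  · simp; norm_num
  · simp; norm_num
  · simp [diagForm_one]; norm_num
  · simp; norm_num [diagForm_one]
  · simp [diagForm_one]

theorem spectralFlow_psl22 (k : ℝ) (ν : Fin 1 → ℝ) :
    SpectralFlow (s := 1) (fun _ => -1 / 2) 0 (e 0) 0 (fun k => k * (k + 1))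
      {![2]} {![-2]} (fun _ => ![2]) (fun _ => ![-2]) ![2] ![-2] ![-1] ![1] k ν := by
  intro M hM h1 h2
  obtain ⟨x, rfl⟩ : ∃ a, ν = ![a] := ⟨ν 0, by ext j; fin_cases j; rfl⟩
  obtain ⟨c, hc⟩ := h1 _ rfl
  have h2 := h2 0
  have hM := hM 0
  rw [hc] at h2
  simp [diagForm_one] at hM hc h2
  have hx : x = -c := by linarith
  have hMk : (M 0 : ℝ) = -k - 1 := by linarith
  -- Here h^∨ = 0, and M = -k - 1 ≥ 0 keeps the denominator k away from 0.
  have hk0 : k ≠ 0 := fun h => by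
    have : (0 : ℝ) ≤ M 0 := by positivity
    linarith
  simp only [diagForm_one, e_one_zero]
  refine ⟨?_, ?_, ?_⟩
  · rintro _ rfl
    refine ⟨M 0 - c, ?_⟩
    rw [Nat.cast_sub h2]
    simp [hx]; ring
  · intro j
    obtain rfl : j = 0 := Subsingleton.elim _ _
    simp [hx]; linarith
  · simp [hx, hMk]
    field_simp
    ring

/-! ### The case D(2,1;m/n). -/

/-- The signs of c and d vary independently, which covers the standard system and the NS systems of
both choices of ρ_R. -/
theorem isUniqueMaximal_D21 (c d : ℝ) (hc : c = 2 ∨ c = -2) (hd : d = 2 ∨ d = -2) (j : Fin 2) :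
    IsUniqueMaximal {![c, 0], ![0, d]} (symm ({(2 : ℝ) • e j} : Set (Fin 2 → ℝ)))
      ((![![c, 0], ![0, d]] : Fin 2 → Fin 2 → ℝ) j) := by
  have key : ∀ x y : ℝ, (![x, y] ∈ symm ({(2 : ℝ) • e 0} : Set (Fin 2 → ℝ)) ↔
      (x = 2 ∨ x = -2) ∧ y = 0) ∧ (![x, y] ∈ symm ({(2 : ℝ) • e 1} : Set (Fin 2 → ℝ)) ↔
      x = 0 ∧ (y = 2 ∨ y = -2)) := by
    intro x y
    simp [symm, e_two_zero, e_two_one, neg_eq_iff_eq_neg]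
    tauto
  fin_cases j
  · rcases hc with rfl | rfl <;> rcases hd with rfl | rfl <;>
      norm_num [IsUniqueMaximal, (key _ _).1]
  · rcases hc with rfl | rfl <;> rcases hd with rfl | rfl <;>
      norm_num [IsUniqueMaximal, (key _ _).2]

theorem finsum_D21 (c d : ℝ) (hc : c ≠ 0) :
    ∑ᶠ α ∈ ({![c, 0], ![0, d]} : Set (Fin 2 → ℝ)), α = ![c, d] := by
  rw [finsum_mem_pair (by simp [hc])]
  simp

theorem iUnion_D21 :
    ⋃ j, ({(2 : ℝ) • e j} : Set (Fin 2 → ℝ)) = {![2, 0], ![0, 2]} := by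
  ext x
  simp [Fin.exists_fin_two, e_two_zero, e_two_one, eq_comm]

theorem explicitData_D21_zero (p q : ℝ) (hp : p < 0) :
    ExplicitData (n := 2) (s := 2) ![p, q] (fun i => {(2 : ℝ) • e i})
      {e 0 + e 1, e 0 - e 1, -e 0 + e 1, -e 0 - e 1} 0 (e 0)
      {![2, 0], ![0, 2]} {![-2, 0], ![0, 2]} ![![2, 0], ![0, 2]] ![![-2, 0], ![0, 2]]
      ![2, 2] ![-2, 2] ![-1, 1] ![1, -1] := by
  -- The element h^R reads off the first coordinate, so the NS system flips the root of the first
  -- ideal only.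
  have hval : ∀ x : Fin 2 → ℝ, 4 * diagForm ![p, q] x (e 0) /
      diagForm ![p, q] ((![![2, 0], ![0, 2]] : Fin 2 → Fin 2 → ℝ) 0)
        ((![![2, 0], ![0, 2]] : Fin 2 → Fin 2 → ℝ) 0) = x 0 := fun x => by
    have := hp.ne
    simp [diagForm_two, e_two_zero]; field_simp; ring
  constructor
  · exact iUnion_D21
  · exact isUniqueMaximal_D21 2 2 (by simp) (by simp)
  · intro x
    rw [hval]
    obtain ⟨a, b, rfl⟩ : ∃ a b, x = ![a, b] := ⟨x 0, x 1, by ext j; fin_cases j <;> rfl⟩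
    simp [symm, neg_eq_iff_eq_neg]
    constructor
    · rintro (⟨(⟨rfl, rfl⟩ | ⟨rfl, rfl⟩) | (⟨rfl, rfl⟩ | ⟨rfl, rfl⟩), h⟩ | ⟨h1, rfl⟩)
      · norm_num at h
      · norm_num at h
      · simp
      · norm_num at h
      · simpa using h1
    · rintro (⟨rfl, rfl⟩ | ⟨rfl, rfl⟩) <;> simp
  · exact isUniqueMaximal_D21 (-2) 2 (by simp) (by simp)
  · exact finsum_D21 _ _ (by simp)
  · exact finsum_D21 _ _ (by simp)
  · simp [e_two_zero, e_two_one]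
  · simp [e_two_zero, e_two_one]; norm_num
  · simp [e_two_zero, e_two_one]; norm_num
  · rw [hval]; simp [e_two_zero, e_two_one]
  · simp only [hval]; simp [e_two_zero, e_two_one]; norm_num
  · simp only [hval]; simp [e_two_zero, e_two_one]; norm_num

/-- Of m and n only the two Gram entries p, q matter: both are negative, their sum is -1/2, and the
polynomial p(k) becomes (k - 2p)(k - 2q). -/
theorem spectralFlow_D21_zero (p q : ℝ) (hp : p < 0) (hq : q < 0) (hpq : p + q = -1 / 2)
    (k : ℝ) (ν : Fin 2 → ℝ) :
    SpectralFlow (s := 2) ![p, q] 0 (e 0) 0 (fun k => (k - 2 * p) * (k - 2 * q))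
      {![2, 0], ![0, 2]} {![-2, 0], ![0, 2]} ![![2, 0], ![0, 2]] ![![-2, 0], ![0, 2]]
      ![2, 2] ![-2, 2] ![-1, 1] ![1, -1] k ν := by
  intro M hM h1 h2
  obtain ⟨x, y, rfl⟩ : ∃ a b, ν = ![a, b] := ⟨ν 0, ν 1, by ext j; fin_cases j <;> rfl⟩
  obtain ⟨c, hc⟩ := h1 _ (Or.inl rfl)
  obtain ⟨d, hd⟩ := h1 _ (Or.inr rfl)
  have hp0 := hp.ne
  have hq0 := hq.ne
  have hM0 := hM 0
  have h20 := h2 0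
  have h21 := h2 1
  simp [diagForm_two] at hM0 hc hd h20 h21
  have hx : x = -c := by field_simp at hc; linarith
  have hy : y = d := by field_simp at hd; linarith
  have hcM : c ≤ M 0 := by rw [hc] at h20; exact_mod_cast h20
  have hdM : d ≤ M 1 := by rw [hd] at h21; exact_mod_cast h21
  have hk : k = 2 * p * (M 0 + 1) := by field_simp at hM0; linarith
  have hN0 : (M 0 : ℝ) + 1 ≠ 0 := by positivity
  simp only [diagForm_two, e_two_zero]
  refine ⟨?_, ?_, ?_⟩
  · rintro _ (rfl | rfl)
    · refine ⟨M 0 - c, ?_⟩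
      rw [Nat.cast_sub hcM]
      simp [hx]; field_simp; ring
    · refine ⟨d, ?_⟩
      simp [hy]; field_simp
  · have hcM' : (c : ℝ) ≤ M 0 := by exact_mod_cast hcM
    have hdM' : (d : ℝ) ≤ M 1 := by exact_mod_cast hdM
    intro j
    fin_cases j
    · simp [hx]; field_simp; linarith
    · simp [hy]; field_simp; linarith
  -- The normalization p + q = -1/2 removes q, leaving an identity of rational functions in p, M, c,
  -- d.
  · obtain rfl : q = -1 / 2 - p := by linarith
    simp [hx, hy, hk]
    field_simp
    ring

theorem explicitData_D21_one (p q : ℝ) (hq : q < 0) :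
    ExplicitData (n := 2) (s := 2) ![p, q] (fun i => {(2 : ℝ) • e i})
      {e 0 + e 1, e 0 - e 1, -e 0 + e 1, -e 0 - e 1} 1 (e 1)
      {![2, 0], ![0, 2]} {![2, 0], ![0, -2]} ![![2, 0], ![0, 2]] ![![2, 0], ![0, -2]]
      ![2, 2] ![2, -2] ![1, -1] ![-1, 1] := by
  have hval : ∀ x : Fin 2 → ℝ, 4 * diagForm ![p, q] x (e 1) /
      diagForm ![p, q] ((![![2, 0], ![0, 2]] : Fin 2 → Fin 2 → ℝ) 1)
        ((![![2, 0], ![0, 2]] : Fin 2 → Fin 2 → ℝ) 1) = x 1 := fun x => by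
    have := hq.ne
    simp [diagForm_two, e_two_one]; field_simp; ring
  constructor
  · exact iUnion_D21
  · exact isUniqueMaximal_D21 2 2 (by simp) (by simp)
  · intro x
    rw [hval]
    obtain ⟨a, b, rfl⟩ : ∃ a b, x = ![a, b] := ⟨x 0, x 1, by ext j; fin_cases j <;> rfl⟩
    simp [symm, neg_eq_iff_eq_neg]
    constructor
    · rintro (⟨(⟨rfl, rfl⟩ | ⟨rfl, rfl⟩) | (⟨rfl, rfl⟩ | ⟨rfl, rfl⟩), h⟩ | ⟨h1, rfl⟩)
      · norm_num at h
      · norm_num at h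
      · norm_num at h
      · simp
      · simpa using h1
    · rintro (⟨rfl, rfl⟩ | ⟨rfl, rfl⟩) <;> simp
  · exact isUniqueMaximal_D21 2 (-2) (by simp) (by simp)
  · exact finsum_D21 _ _ (by simp)
  · exact finsum_D21 _ _ (by simp)
  · simp [e_two_zero, e_two_one]
  · simp [e_two_zero, e_two_one]; norm_num
  · simp [e_two_zero, e_two_one]; norm_num
  · rw [hval]; simp [e_two_zero, e_two_one]
  · simp only [hval]; simp [e_two_zero, e_two_one]; norm_num
  · simp only [hval]; simp [e_two_zero, e_two_one]; norm_num

theorem spectralFlow_D21_one (p q : ℝ) (hp : p < 0) (hq : q < 0) (hpq : p + q = -1 / 2)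
    (k : ℝ) (ν : Fin 2 → ℝ) :
    SpectralFlow (s := 2) ![p, q] 1 (e 1) 0 (fun k => (k - 2 * p) * (k - 2 * q))
      {![2, 0], ![0, 2]} {![2, 0], ![0, -2]} ![![2, 0], ![0, 2]] ![![2, 0], ![0, -2]]
      ![2, 2] ![2, -2] ![1, -1] ![-1, 1] k ν := by
  intro M hM h1 h2
  obtain ⟨x, y, rfl⟩ : ∃ a b, ν = ![a, b] := ⟨ν 0, ν 1, by ext j; fin_cases j <;> rfl⟩
  obtain ⟨c, hc⟩ := h1 _ (Or.inl rfl)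
  obtain ⟨d, hd⟩ := h1 _ (Or.inr rfl)
  have hp0 := hp.ne
  have hq0 := hq.ne
  have hM1 := hM 1
  have h20 := h2 0
  have h21 := h2 1
  simp [diagForm_two] at hM1 hc hd h20 h21
  have hx : x = c := by field_simp at hc; linarith
  have hy : y = -d := by field_simp at hd; linarith
  have hcM : c ≤ M 0 := by rw [hc] at h20; exact_mod_cast h20
  have hdM : d ≤ M 1 := by rw [hd] at h21; exact_mod_cast h21
  have hk : k = 2 * q * (M 1 + 1) := by field_simp at hM1; linarith
  have hN0 : (M 1 : ℝ) + 1 ≠ 0 := by positivity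
  simp only [diagForm_two, e_two_one]
  refine ⟨?_, ?_, ?_⟩
  · rintro _ (rfl | rfl)
    · refine ⟨c, ?_⟩
      simp [hx]; field_simp
    · refine ⟨M 1 - d, ?_⟩
      rw [Nat.cast_sub hdM]
      simp [hy]; field_simp; ring
  · have hcM' : (c : ℝ) ≤ M 0 := by exact_mod_cast hcM
    have hdM' : (d : ℝ) ≤ M 1 := by exact_mod_cast hdM
    intro j
    fin_cases j
    · simp [hx]; field_simp; linarith
    · simp [hy]; field_simp; linarith
  · obtain rfl : p = -1 / 2 - q := by linarith
    simp [hx, hy, hk]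
    field_simp
    ring

/-! ### The case F(4). -/

@[simp]
theorem vec_three_two (a b c : ℝ) : ![a, b, c] 2 = c := rfl

theorem vec_three_eta (x : Fin 3 → ℝ) : ∃ a b c, x = ![a, b, c] :=
  ⟨x 0, x 1, x 2, by ext j; fin_cases j <;> rfl⟩

theorem e_three_zero : (e 0 : Fin 3 → ℝ) = ![1, 0, 0] := by ext a; fin_cases a <;> simp [e]

theorem e_three_one : (e 1 : Fin 3 → ℝ) = ![0, 1, 0] := by ext a; fin_cases a <;> simp [e]

theorem e_three_two : (e 2 : Fin 3 → ℝ) = ![0, 0, 1] := by ext a; fin_cases a <;> simp [e]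

/-- The roots of `so(7)` that are positive for the standard system reflected by `t = ±1` in the first
coordinate. -/
def rootsB3 (t : ℝ) : Set (Fin 3 → ℝ) :=
  {![t, 1, 0], ![t, 0, 1], ![0, 1, 1], ![t, -1, 0], ![t, 0, -1], ![0, 1, -1],
      ![t, 0, 0], ![0, 1, 0], ![0, 0, 1]}

theorem posB_three : posB 3 = rootsB3 1 := by
  apply Set.Subset.antisymm
  · rintro x (⟨a, b, hab, rfl | rfl⟩ | ⟨a, rfl⟩)
    · fin_cases a <;> fin_cases b <;>
        first
        | exact absurd hab (by decide)
        | simp [rootsB3, e_three_zero, e_three_one, e_three_two]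
    · fin_cases a <;> fin_cases b <;>
        first
        | exact absurd hab (by decide)
        | (simp [rootsB3, e_three_zero, e_three_one, e_three_two]; done)
        | (simp [rootsB3, e_three_zero, e_three_one]
           exact Or.inr (by ext j; fin_cases j; rfl))
    · fin_cases a <;> simp [rootsB3, e_three_zero, e_three_one, e_three_two]
  · rintro _ (rfl | rfl | rfl | rfl | rfl | rfl | rfl | rfl | rfl)
    · exact Or.inl ⟨0, 1, by decide, Or.inl (by simp [e_three_zero, e_three_one])⟩
    · exact Or.inl ⟨0, 2, by decide, Or.inl (by simp [e_three_zero, e_three_two])⟩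
    · exact Or.inl ⟨1, 2, by decide, Or.inl (by simp [e_three_one, e_three_two])⟩
    · exact Or.inl ⟨0, 1, by decide, Or.inr (by simp [e_three_zero, e_three_one])⟩
    · exact Or.inl ⟨0, 2, by decide, Or.inr (by simp [e_three_zero, e_three_two])⟩
    · exact Or.inl ⟨1, 2, by decide, Or.inr (by simp [e_three_one, e_three_two])⟩
    · exact Or.inr ⟨0, e_three_zero.symm⟩
    · exact Or.inr ⟨1, e_three_one.symm⟩
    · exact Or.inr ⟨2, e_three_two.symm⟩

theorem sq_le_of_mem_rootsB3 {t : ℝ} (ht : t = 1 ∨ t = -1) {x : Fin 3 → ℝ}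
    (hx : x ∈ rootsB3 t) : x 0 ^ 2 + x 1 ^ 2 + x 2 ^ 2 ≤ 2 := by
  rcases hx with rfl | rfl | rfl | rfl | rfl | rfl | rfl | rfl | rfl <;>
    rcases ht with rfl | rfl <;> norm_num

/-- The root system of so(7) is stable under the sign change of the first coordinate. Hence
statements about `rootsB3 t` with its own symmetric closure serve both sectors. -/
theorem symm_rootsB3_neg (t : ℝ) : symm (rootsB3 (-t)) = symm (rootsB3 t) := by
  have key : ∀ u, ∀ x ∈ rootsB3 u, x ∈ symm (rootsB3 (-u)) := by
    rintro u _ (rfl | rfl | rfl | rfl | rfl | rfl | rfl | rfl | rfl) <;> simp [symm, rootsB3]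
  have key' : ∀ u, symm (rootsB3 u) ⊆ symm (rootsB3 (-u)) := by
    rintro u x (hx | hx)
    · exact key u x hx
    · have := key u _ hx
      rwa [symm, Set.mem_ofPred_eq, neg_neg, or_comm] at this
  exact Set.Subset.antisymm (by simpa using key' (-t)) (key' t)

theorem isUniqueMaximal_rootsB3 {t : ℝ} (ht : t = 1 ∨ t = -1) :
    IsUniqueMaximal (rootsB3 t) (symm (rootsB3 t)) ![t, 1, 0] := by
  have hnorm : ∀ x ∈ symm (rootsB3 t), x 0 ^ 2 + x 1 ^ 2 + x 2 ^ 2 ≤ 2 := by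
    rintro x (hx | hx)
    · exact sq_le_of_mem_rootsB3 ht hx
    · simpa using sq_le_of_mem_rootsB3 ht hx
  refine ⟨⟨Or.inl (by simp [rootsB3]), by simp [rootsB3], fun α hα h => ?_⟩, fun y hy _ hne => ?_⟩
  -- Adding any positive root to the highest one gives squared length above 2, the maximum over
  -- roots.
  · have := hnorm _ h
    rcases hα with rfl | rfl | rfl | rfl | rfl | rfl | rfl | rfl | rfl <;>
      rcases ht with rfl | rfl <;> norm_num at this
  · have hex : ∀ z ∈ rootsB3 t, z - y ∈ rootsB3 t → ∃ α ∈ rootsB3 t, y + α ∈ symm (rootsB3 t) :=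
      fun z hz h => ⟨z - y, h, Or.inl (by simpa using hz)⟩
    rcases hy with rfl | rfl | rfl | rfl | rfl | rfl | rfl | rfl | rfl
    · exact absurd rfl hne
    · exact hex ![t, 1, 0] (by simp [rootsB3]) (by simp [rootsB3])
    · exact ⟨![t, 0, -1], by simp [rootsB3], by simp [symm, rootsB3]⟩
    · exact ⟨![0, 1, 0], by simp [rootsB3], by simp [symm, rootsB3]⟩
    · exact ⟨![0, 0, 1], by simp [rootsB3], by simp [symm, rootsB3]⟩
    · exact ⟨![0, 0, 1], by simp [rootsB3], by simp [symm, rootsB3]⟩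
    · exact ⟨![0, 1, 0], by simp [rootsB3], by simp [symm, rootsB3]⟩
    · exact ⟨![t, 0, 0], by simp [rootsB3], by simp [symm, rootsB3]⟩
    · exact ⟨![0, 1, 0], by simp [rootsB3], by simp [symm, rootsB3]⟩

theorem finsum_rootsB3 {t : ℝ} (ht : t ≠ 0) : ∑ᶠ α ∈ rootsB3 t, α = ![5 * t, 3, 1] := by
  classical
  have h : rootsB3 t = (({![t, 1, 0], ![t, 0, 1], ![0, 1, 1], ![t, -1, 0], ![t, 0, -1], ![0, 1, -1],
      ![t, 0, 0], ![0, 1, 0], ![0, 0, 1]} : Finset (Fin 3 → ℝ)) : Set (Fin 3 → ℝ)) := by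
    simp [rootsB3]
  have h1 : (1 : ℝ) ≠ -1 := by norm_num
  have h2 : (-1 : ℝ) ≠ 1 := by norm_num
  rw [h, finsum_mem_coe_finset]
  repeat rw [Finset.sum_insert (by simp [ht, ht.symm, h1, h2])]
  rw [Finset.sum_singleton]
  simp
  refine ⟨by ring, by norm_num⟩

theorem explicitData_F4 :
    ExplicitData (n := 3) (s := 1) (fun _ => -2 / 3) (fun _ => posB 3)
      {η | ∀ a, η a = 1 / 2 ∨ η a = -1 / 2} 0 (e 0)
      (rootsB3 1) (rootsB3 (-1)) (fun _ => ![1, 1, 0]) (fun _ => ![-1, 1, 0])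
      ![5, 3, 1] ![-5, 3, 1] ![-1 / 2, 1 / 2, 1 / 2] ![1 / 2, -1 / 2, -1 / 2] := by
  -- The element h^R is twice the first coordinate, so the NS system is the standard one reflected
  -- in that coordinate, `rootsB3 (-1)`.
  have hval : ∀ x : Fin 3 → ℝ, 4 * diagForm (fun _ => -2 / 3) x (e 0) /
      diagForm (fun _ => -2 / 3) (![1, 1, 0] : Fin 3 → ℝ) ![1, 1, 0] = 2 * x 0 := fun x => by
    simp [diagForm_three, e_three_zero]; ring
  have hhalf : ∀ x y z : ℝ, ![x, y, z] ∈ {η : Fin 3 → ℝ | ∀ a, η a = 1 / 2 ∨ η a = -1 / 2} ↔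
      (x = 1 / 2 ∨ x = -1 / 2) ∧ (y = 1 / 2 ∨ y = -1 / 2) ∧ (z = 1 / 2 ∨ z = -1 / 2) := by
    intro x y z
    simp [Fin.forall_fin_succ]
  have hsq : ∀ x ∈ {η : Fin 3 → ℝ | ∀ a, η a = 1 / 2 ∨ η a = -1 / 2}, 
      x 0 ^ 2 + x 1 ^ 2 + x 2 ^ 2 = 3 / 4 := by
    intro x hx
    have h (a) : x a ^ 2 = 1 / 4 := by rcases hx a with h | h <;> rw [h] <;> norm_num
    rw [h, h, h]; norm_num
  constructor
  · rw [posB_three]; exact Set.iUnion_const _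
  · intro j
    rw [posB_three]; exact isUniqueMaximal_rootsB3 (by simp)
  · intro x
    rw [hval, ← symm_rootsB3_neg 1]
    constructor
    · rintro (⟨hx | hx, h⟩ | ⟨hx, h⟩)
      · exact hx
      · obtain ⟨y, rfl⟩ : ∃ y, x = -y := ⟨-x, by simp⟩
        rw [neg_neg] at hx
        rcases hx with rfl | rfl | rfl | rfl | rfl | rfl | rfl | rfl | rfl <;> norm_num at h
      · rcases hx with rfl | rfl | rfl | rfl | rfl | rfl | rfl | rfl | rfl <;>
          simp [rootsB3] at h ⊢
    · intro hx
      have hx' : x ∈ symm (rootsB3 (-1)) := Or.inl hx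
      rcases hx with rfl | rfl | rfl | rfl | rfl | rfl | rfl | rfl | rfl
      · exact Or.inl ⟨hx', by norm_num⟩
      · exact Or.inl ⟨hx', by norm_num⟩
      · exact Or.inr (by simp [rootsB3])
      · exact Or.inl ⟨hx', by norm_num⟩
      · exact Or.inl ⟨hx', by norm_num⟩
      · exact Or.inr (by simp [rootsB3])
      · exact Or.inl ⟨hx', by norm_num⟩
      · exact Or.inr (by simp [rootsB3])
      · exact Or.inr (by simp [rootsB3])
  · intro j
    rw [posB_three, ← symm_rootsB3_neg 1]
    exact isUniqueMaximal_rootsB3 (by simp)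
  · rw [finsum_rootsB3 (by norm_num)]; norm_num
  · rw [finsum_rootsB3 (by norm_num)]; norm_num
  · rw [hhalf]; simp
  · intro α hα h
    -- All spin weights have squared length 3/4, which rules out every ξ + α.
    have hs := hsq _ h
    rcases hα with rfl | rfl | rfl | rfl | rfl | rfl | rfl | rfl | rfl <;>
      norm_num at hs
  · intro y hy hne
    obtain ⟨a, b, c, rfl⟩ : ∃ a b c, y = ![a, b, c] := vec_three_eta y
    obtain ⟨ha, hb, hc⟩ := (hhalf _ _ _).1 hy
    have key : ∀ α ∈ rootsB3 (-1), (a + α 0 = 1 / 2 ∨ a + α 0 = -1 / 2) →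
        (b + α 1 = 1 / 2 ∨ b + α 1 = -1 / 2) → (c + α 2 = 1 / 2 ∨ c + α 2 = -1 / 2) →
        ∃ α ∈ rootsB3 (-1), ![a, b, c] + α ∈
          {η : Fin 3 → ℝ | ∀ a, η a = 1 / 2 ∨ η a = -1 / 2} :=
      fun α hα h0 h1 h2 => ⟨α, hα, by
        intro j; fin_cases j
        · exact h0
        · exact h1
        · exact h2⟩
    rcases ha with rfl | rfl
    · exact key ![-1, 0, 0] (by simp [rootsB3]) (by norm_num) (by simpa using hb) (by simpa using hc)
    · rcases hb with rfl | rfl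
      · rcases hc with rfl | rfl
        · exact absurd rfl hne
        · exact key ![0, 0, 1] (by simp [rootsB3]) (by norm_num) (by norm_num) (by norm_num)
      · exact key ![0, 1, 0] (by simp [rootsB3]) (by norm_num) (by norm_num) (by simpa using hc)
  · rw [hval, hhalf]; norm_num
  · intro α hα h
    rw [hval]
    have hs := hsq _ h
    rcases hα with rfl | rfl | rfl | rfl | rfl | rfl | rfl | rfl | rfl <;>
      first | (norm_num; done) | norm_num at hs
  · intro y hy h0 hne
    simp only [hval] at h0 ⊢
    obtain ⟨a, b, c, rfl⟩ : ∃ a b c, y = ![a, b, c] := vec_three_eta y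
    obtain ⟨ha, hb, hc⟩ := (hhalf _ _ _).1 hy
    rcases ha with rfl | rfl
    · have key : ∀ y z : ℝ, ![0, y, z] ∈ rootsB3 1 → (b - y = 1 / 2 ∨ b - y = -1 / 2) →
          (c - z = 1 / 2 ∨ c - z = -1 / 2) →
          ∃ α ∈ rootsB3 1, ![1 / 2, b, c] - α ∈
            {η : Fin 3 → ℝ | ∀ a, η a = 1 / 2 ∨ η a = -1 / 2} ∧
            0 < 2 * (![1 / 2, b, c] - α) 0 :=
        fun y z hα h1 h2 => ⟨![0, y, z], hα, by
          intro j; fin_cases j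
          · simp
          · exact h1
          · exact h2, by simp⟩
      rcases hb with rfl | rfl
      · exact key 1 0 (by simp [rootsB3]) (by norm_num) (by simpa using hc)
      · rcases hc with rfl | rfl
        · exact key 0 1 (by simp [rootsB3]) (by norm_num) (by norm_num)
        · exact absurd rfl hne
    · norm_num at h0

theorem spectralFlow_F4 (k : ℝ) (ν : Fin 3 → ℝ) :
    SpectralFlow (s := 1) (fun _ => -2 / 3) 0 (e 0) (-2) (fun k => (k + 2 / 3) * (k - 2 / 3))
      (rootsB3 1) (rootsB3 (-1)) (fun _ => ![1, 1, 0]) (fun _ => ![-1, 1, 0])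
      ![5, 3, 1] ![-5, 3, 1] ![-1 / 2, 1 / 2, 1 / 2] ![1 / 2, -1 / 2, -1 / 2] k ν := by
  intro M hM h1 h2
  obtain ⟨x, y, z, rfl⟩ : ∃ a b c, ν = ![a, b, c] := vec_three_eta ν
  obtain ⟨c1, hc1⟩ := h1 ![-1, 1, 0] (by simp [rootsB3])
  obtain ⟨c2, hc2⟩ := h1 ![-1, 0, 1] (by simp [rootsB3])
  obtain ⟨c3, hc3⟩ := h1 ![0, 1, 1] (by simp [rootsB3])
  obtain ⟨c4, hc4⟩ := h1 ![-1, -1, 0] (by simp [rootsB3])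
  obtain ⟨c5, hc5⟩ := h1 ![-1, 0, -1] (by simp [rootsB3])
  obtain ⟨c6, hc6⟩ := h1 ![0, 1, -1] (by simp [rootsB3])
  obtain ⟨c7, hc7⟩ := h1 ![-1, 0, 0] (by simp [rootsB3])
  obtain ⟨c8, hc8⟩ := h1 ![0, 1, 0] (by simp [rootsB3])
  obtain ⟨c9, hc9⟩ := h1 ![0, 0, 1] (by simp [rootsB3])
  have hM := hM 0
  have h2 := h2 0
  have p4 := Nat.cast_nonneg (α := ℝ) c4
  have p6 := Nat.cast_nonneg (α := ℝ) c6
  have p8 := Nat.cast_nonneg (α := ℝ) c8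
  have p9 := Nat.cast_nonneg (α := ℝ) c9
  have pM := Nat.cast_nonneg (α := ℝ) (M 0)
  norm_num [diagForm_three] at hM h2 hc1 hc2 hc3 hc4 hc5 hc6 hc7 hc8 hc9
  have hMk : (M 0 : ℝ) = -3 * k / 2 - 1 := by linarith
  have hk0 : k + -2 ≠ 0 := fun h => by linarith
  simp only [diagForm_three, e_three_zero]
  have key : ∀ (u : ℝ) (A c : ℕ), (c : ℝ) ≤ A → u = A - c → ∃ d : ℕ, u = d := fun u A c h hu =>
    ⟨A - c, by rw [hu, Nat.cast_sub (by exact_mod_cast h)]⟩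
  refine ⟨?_, ?_, ?_⟩
  · rintro _ (rfl | rfl | rfl | rfl | rfl | rfl | rfl | rfl | rfl)
    · refine key _ (M 0) c4 (by linarith) ?_
      norm_num; linarith
    · refine key _ (M 0) c5 (by linarith) ?_
      norm_num; linarith
    · refine ⟨c3, ?_⟩
      norm_num; linarith
    · refine key _ (M 0) c1 (by linarith) ?_
      norm_num; linarith
    · refine key _ (M 0) c2 (by linarith) ?_
      norm_num; linarith
    · refine ⟨c6, ?_⟩
      norm_num; linarith
    -- The short root ε_1 has coroot value 2 on ρ_R, whence 2M. The bound holds since c7 = c1 + c4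
    -- with c4 ≤ c1 ≤ M.
    · refine key _ (2 * M 0) c7 (by push_cast; linarith) ?_
      norm_num; linarith
    · refine ⟨c8, ?_⟩
      norm_num; linarith
    · refine ⟨c9, ?_⟩
      norm_num; linarith
  · intro j
    obtain rfl : j = 0 := Subsingleton.elim _ _
    norm_num; linarith
  · simp [hMk]
    field_simp
    ring

/-! ### Root systems of type D built on an orthonormal family. -/

section TypeD

variable {n : ℕ}

/-- The vectors `f a ± f b`, `a < b`, attached to a family `f`. -/
def rootsD {m : ℕ} (f : Fin m → Fin n → ℝ) : Set (Fin n → ℝ) :=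
  {α | ∃ a b : Fin m, a < b ∧ (α = f a + f b ∨ α = f a - f b)}

/-- Orthonormality for the standard dot product. -/
def DotOrthonormal {m : ℕ} (f : Fin m → Fin n → ℝ) : Prop :=
  ∀ a b, f a ⬝ᵥ f b = if a = b then 1 else 0

/-- The family -f_{rev a} describes the NS sector: its sums are the -f_a - f_b and its differences
f_a - f_b keep the original order. Results on `rootsD` thus apply to both positive systems. -/
theorem DotOrthonormal.neg_rev {m : ℕ} {f : Fin m → Fin n → ℝ} (hf : DotOrthonormal f) :
    DotOrthonormal fun a => -f a.rev := fun a b => by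
  simp [neg_dotProduct, dotProduct_neg, hf _ _]

variable {m : ℕ} {f : Fin m → Fin n → ℝ}

theorem dotProduct_self_of_mem_symm_rootsD (hf : DotOrthonormal f) {x : Fin n → ℝ}
    (hx : x ∈ symm (rootsD f)) : x ⬝ᵥ x = 2 := by
  have key : ∀ y ∈ rootsD f, y ⬝ᵥ y = 2 := by
    rintro _ ⟨a, b, hab, rfl | rfl⟩ <;>
      simp [add_dotProduct, dotProduct_add, sub_dotProduct, dotProduct_sub, hf _ _, hab.ne,
        hab.ne'] <;> norm_num
  rcases hx with hx | hx
  · exact key x hx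
  · simpa [neg_dotProduct, dotProduct_neg] using key _ hx

theorem add_mem_rootsD (f : Fin m → Fin n → ℝ) {a b : Fin m} (h : a ≠ b) :
    f a + f b ∈ rootsD f := by
  rcases h.lt_or_gt with h | h
  · exact ⟨a, b, h, Or.inl rfl⟩
  · exact ⟨b, a, h, Or.inl (add_comm _ _)⟩

theorem sub_mem_rootsD (f : Fin m → Fin n → ℝ) {a b : Fin m} (h : a < b) :
    f a - f b ∈ rootsD f := ⟨a, b, h, Or.inr rfl⟩

theorem symm_rootsD_neg_rev (f : Fin m → Fin n → ℝ) :
    symm (rootsD fun a => -f a.rev) = symm (rootsD f) := by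
  have key : ∀ (g : Fin m → Fin n → ℝ), ∀ x ∈ rootsD g, x ∈ symm (rootsD fun a => -g a.rev) := by
    rintro g _ ⟨a, b, hab, rfl | rfl⟩
    · refine Or.inr ⟨b.rev, a.rev, Fin.rev_lt_rev.2 hab, Or.inl ?_⟩
      simp only [Fin.rev_rev]; abel
    · refine Or.inl ⟨b.rev, a.rev, Fin.rev_lt_rev.2 hab, Or.inr ?_⟩
      simp only [Fin.rev_rev]; abel
  have key' : ∀ (g : Fin m → Fin n → ℝ), symm (rootsD g) ⊆ symm (rootsD fun a => -g a.rev) := by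
    rintro g x (hx | hx)
    · exact key g x hx
    · have := key g _ hx
      rwa [symm, Set.mem_ofPred_eq, neg_neg, or_comm] at this
  exact Set.Subset.antisymm (by simpa using key' fun a => -f a.rev) (key' f)

/-- For each pair a < b the two roots f_a ± f_b add up to 2f_a, and m - 1 - a indices b lie above a.
-/
theorem finsum_rootsD (hf : DotOrthonormal f) :
    ∑ᶠ α ∈ rootsD f, α = ∑ a : Fin m, (2 * ((m : ℝ) - 1 - a)) • f a := by
  classical
  set S : Finset (Fin m × Fin m) := Finset.univ.filter fun p => p.1 < p.2 with hS
  have hrange : rootsD f = (fun p : Fin m × Fin m => f p.1 + f p.2) '' S ∪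
      (fun p : Fin m × Fin m => f p.1 - f p.2) '' S := by
    ext x
    simp only [rootsD, hS, Set.mem_ofPred_eq, Set.mem_union, Set.mem_image, Prod.exists,
      Finset.coe_filter, Finset.mem_univ, true_and]
    constructor
    · rintro ⟨a, b, hab, rfl | rfl⟩
      · exact Or.inl ⟨a, b, hab, rfl⟩
      · exact Or.inr ⟨a, b, hab, rfl⟩
    · rintro (⟨a, b, hab, rfl⟩ | ⟨a, b, hab, rfl⟩)
      · exact ⟨a, b, hab, Or.inl rfl⟩
      · exact ⟨a, b, hab, Or.inr rfl⟩
  have hmem : ∀ p ∈ (S : Set (Fin m × Fin m)), p.1 < p.2 := fun p hp => by simpa [hS] using hp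
  have hinj : ∀ ε : ℝ, (ε = 1 ∨ ε = -1) → ∀ a b c d : Fin m, a < b → c < d →
      f a + ε • f b = f c + ε • f d → a = c ∧ b = d := by
    intro ε hε a b c d hab hcd h
    have hdot : ∀ j, (if a = j then (1 : ℝ) else 0) + ε * (if b = j then 1 else 0) =
        (if c = j then 1 else 0) + ε * (if d = j then 1 else 0) := fun j => by
      have := congrArg (· ⬝ᵥ f j) h
      simpa only [add_dotProduct, smul_dotProduct, hf _ _, smul_eq_mul] using this
    have hac : a = c := by
      by_contra hac
      -- If a ≠ c, the coefficient of f_a forces d = a and that of f_c forces b = c, giving the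
      -- cycle a < b = c < d = a.
      have hda : d = a := by
        by_contra hda
        have := hdot a
        simp [hab.ne', Ne.symm hac, hda] at this
      have hbc : b = c := by
        by_contra hbc
        have := hdot c
        simp [hcd.ne', hac, hbc] at this
      exact absurd (hab.trans (hbc ▸ hcd)) (by rw [hda]; exact lt_irrefl _)
    refine ⟨hac, ?_⟩
    by_contra hbd
    have := hdot b
    rw [hac] at this
    rcases hε with rfl | rfl <;> simp [Ne.symm hbd] at this
  have h1 : Set.InjOn (fun p : Fin m × Fin m => f p.1 + f p.2) S := fun p hp q hq h => by
    have := hinj 1 (Or.inl rfl) _ _ _ _ (hmem p hp) (hmem q hq) (by simpa using h)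
    exact Prod.ext this.1 this.2
  have h2 : Set.InjOn (fun p : Fin m × Fin m => f p.1 - f p.2) S := fun p hp q hq h => by
    have := hinj (-1) (Or.inr rfl) _ _ _ _ (hmem p hp) (hmem q hq)
      (by simpa [sub_eq_add_neg] using h)
    exact Prod.ext this.1 this.2
  have hdisj : Disjoint ((fun p : Fin m × Fin m => f p.1 + f p.2) '' S)
      ((fun p : Fin m × Fin m => f p.1 - f p.2) '' S) := by
    rw [Set.disjoint_left]
    rintro _ ⟨p, hp, rfl⟩ ⟨q, hq, h⟩
    -- A difference has coefficient -1 at its second index, while a sum has no negative coefficient.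
    have h := congrArg (· ⬝ᵥ f q.2) h
    simp only [add_dotProduct, sub_dotProduct, hf _ _, (hmem q hq).ne, if_true, if_false] at h
    split_ifs at h <;> norm_num at h
  rw [hrange, finsum_mem_union hdisj (S.finite_toSet.image _) (S.finite_toSet.image _),
    finsum_mem_image h1, finsum_mem_image h2, finsum_mem_coe_finset, finsum_mem_coe_finset,
    ← Finset.sum_add_distrib, hS, Finset.sum_filter, Fintype.sum_prod_type]
  refine Finset.sum_congr rfl fun a _ => ?_
  have hcard : (((Finset.univ.filter fun b => a < b).card : ℕ) : ℝ) = (m : ℝ) - 1 - a := by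
    have : (Finset.univ.filter fun b => a < b) = Finset.Ioi a := by ext; simp
    rw [this, Fin.card_Ioi, Nat.sub_sub, Nat.cast_sub (by omega)]
    push_cast; ring
  rw [← Finset.sum_filter, ← hcard]
  rw [Finset.sum_congr rfl fun b _ => show f a + f b + (f a - f b) = (2 : ℝ) • f a by
    rw [two_smul]; abel]
  rw [Finset.sum_const, ← Nat.cast_smul_eq_nsmul ℝ, smul_smul, mul_comm]

end TypeD

/-! ### Highest roots, weights and spectral flow for so(2r), r = q + 3. -/

section TypeDRank

variable {n q : ℕ} {f : Fin (q + 3) → Fin n → ℝ}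

theorem isUniqueMaximal_rootsD (hf : DotOrthonormal f) :
    IsUniqueMaximal (rootsD f) (symm (rootsD f)) (f 0 + f 1) := by
  have h01 : (0 : Fin (q + 3)) ≠ 1 := by simp
  refine ⟨⟨Or.inl (add_mem_rootsD f h01), add_mem_rootsD f h01, fun α hα h => ?_⟩,
    fun y hy _ hne => ?_⟩
  · have h2 := dotProduct_self_of_mem_symm_rootsD hf h
    have h3 := dotProduct_self_of_mem_symm_rootsD hf (Or.inl hα)
    have h4 := dotProduct_self_of_mem_symm_rootsD hf (Or.inl (add_mem_rootsD f h01))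
    rw [add_dotProduct, dotProduct_add _ _ α, dotProduct_add α, h3, h4, dotProduct_comm α] at h2
    -- The candidate f_0 + f_1 is dominant, so its sum with α has squared length at least 4, whereas
    -- roots have squared length 2.
    have h5 : 0 ≤ (f 0 + f 1) ⬝ᵥ α := by
      obtain ⟨a, b, hab, rfl | rfl⟩ := hα
      · simp only [add_dotProduct, dotProduct_add, hf _ _]
        split_ifs <;> norm_num
      · simp only [add_dotProduct, dotProduct_sub, hf _ _]
        rw [if_neg ((Fin.zero_le a).trans_lt hab).ne]
        by_cases hb : 1 = b
        · have ha : 0 = a := Fin.ext (by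
            rw [← hb, Fin.lt_def, Fin.val_one] at hab
            rw [Fin.val_zero]; omega)
          rw [if_pos hb, if_pos ha]
          split_ifs <;> norm_num
        · rw [if_neg hb]
          split_ifs <;> norm_num
    linarith
  · have hadd : ∀ α ∈ rootsD f, ∀ a b : Fin (q + 3), a ≠ b → y + α = f a + f b →
        ∃ α ∈ rootsD f, y + α ∈ symm (rootsD f) := fun α hα a b hab h =>
      ⟨α, hα, Or.inl (h ▸ add_mem_rootsD f hab)⟩
    obtain ⟨a, b, hab, rfl | rfl⟩ := hy
    · by_cases ha : a = 0
      · subst ha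
        have hb : (1 : Fin (q + 3)) < b := by
          refine lt_of_le_of_ne ?_ fun h => hne (by rw [h])
          rw [Fin.lt_def] at hab; rw [Fin.le_def]
          simpa [Nat.one_le_iff_ne_zero, Nat.pos_iff_ne_zero] using hab
        exact hadd _ (sub_mem_rootsD f hb) 0 1 h01 (by abel)
      · exact hadd _ (sub_mem_rootsD f (Fin.pos_of_ne_zero ha)) 0 b
          ((Fin.zero_le a).trans_lt hab).ne (by abel)
    · by_cases ha : a = 0
      · subst ha
        -- A third index c exists because the rank is at least 3. In so(4), which is not simple, f_0
        -- - f_1 would be a second maximal root.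
        obtain ⟨c, hc0, hcb⟩ : ∃ c : Fin (q + 3), 0 ≠ c ∧ b ≠ c := by
          by_cases hb : b = 1
          · exact ⟨⟨2, by omega⟩, by simp [Fin.ext_iff], by rw [hb]; simp [Fin.ext_iff]⟩
          · exact ⟨1, h01, hb⟩
        exact hadd _ (add_mem_rootsD f hcb) 0 c hc0 (by abel)
      · refine ⟨f 0 - f a, sub_mem_rootsD f (Fin.pos_of_ne_zero ha), Or.inl ?_⟩
        rw [show f a - f b + (f 0 - f a) = f 0 - f b by abel]
        exact sub_mem_rootsD f ((Fin.zero_le a).trans_lt hab)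

/-- The weights `± f a`. -/
def weightsD {n m : ℕ} (f : Fin m → Fin n → ℝ) : Set (Fin n → ℝ) :=
  {η | ∃ a, η = f a ∨ η = -f a}

theorem weightsD_neg_rev {n m : ℕ} (f : Fin m → Fin n → ℝ) :
    weightsD (fun a => -f a.rev) = weightsD f := by
  ext x
  constructor
  · rintro ⟨a, rfl | rfl⟩
    · exact ⟨_, Or.inr rfl⟩
    · exact ⟨a.rev, Or.inl (neg_neg _)⟩
  · rintro ⟨a, rfl | rfl⟩
    · exact ⟨a.rev, Or.inr (by simp)⟩
    · exact ⟨a.rev, Or.inl (by simp)⟩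

theorem dotProduct_self_of_mem_weightsD {n m : ℕ} {f : Fin m → Fin n → ℝ} (hf : DotOrthonormal f)
    {x : Fin n → ℝ} (hx : x ∈ weightsD f) : x ⬝ᵥ x = 1 := by
  obtain ⟨a, rfl | rfl⟩ := hx <;> simp [neg_dotProduct, dotProduct_neg, hf _ _]

/-- Since f_0 pairs non-negatively with positive roots, f_0 + α has squared length at least 3, while
weights have length 1. -/
theorem add_notMem_weightsD (hf : DotOrthonormal f) {α : Fin n → ℝ} (hα : α ∈ rootsD f) :
    f 0 + α ∉ weightsD f := fun h => by
  have h2 := dotProduct_self_of_mem_weightsD hf h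
  have h3 := dotProduct_self_of_mem_symm_rootsD hf (Or.inl hα)
  rw [add_dotProduct, dotProduct_add, dotProduct_add, h3, hf, if_pos rfl, dotProduct_comm α] at h2
  have h5 : 0 ≤ f 0 ⬝ᵥ α := by
    obtain ⟨a, b, hab, rfl | rfl⟩ := hα
    · simp only [dotProduct_add, hf _ _]
      split_ifs <;> norm_num
    · simp only [dotProduct_sub, hf _ _, ((Fin.zero_le a).trans_lt hab).ne, if_false]
      split_ifs <;> norm_num
  linarith

theorem exists_add_mem_weightsD (f : Fin (q + 3) → Fin n → ℝ) {y : Fin n → ℝ}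
    (hy : y ∈ weightsD f) (hne : y ≠ f 0) : ∃ α ∈ rootsD f, y + α ∈ weightsD f := by
  have h01 : (0 : Fin (q + 3)) ≠ 1 := by simp
  obtain ⟨a, rfl | rfl⟩ := hy
  · have ha : a ≠ 0 := fun h => hne (by rw [h])
    exact ⟨_, sub_mem_rootsD f (Fin.pos_of_ne_zero ha), 0, Or.inl (by abel)⟩
  · by_cases ha : a = 0
    · subst ha
      exact ⟨_, add_mem_rootsD f h01, 1, Or.inl (by abel)⟩
    · exact ⟨_, add_mem_rootsD f (Ne.symm ha), 0, Or.inl (by abel)⟩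

/-- The condition f_a · ρ = 1/2 makes h^R equal to 2 on every f_a + f_b and 0 on every f_a - f_b.
Only the sums change sign in the NS system. -/
theorem explicitData_D {pos : Set (Fin n → ℝ)} {halfWeights : Set (Fin n → ℝ)} {ρ : Fin n → ℝ}
    (hf : DotOrthonormal f) (hpos : pos = rootsD f) (hhalf : halfWeights = weightsD f)
    (hρ : ∀ a, f a ⬝ᵥ ρ = 1 / 2) :
    ExplicitData (s := 1) (fun _ => -1 / 2) (fun _ => pos) halfWeights 0 ρ
      (rootsD f) (rootsD fun a => -f a.rev) (fun _ => f 0 + f 1)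
      (fun _ => -f (Fin.last (q + 2)) + -f (Fin.rev 1))
      (∑ a : Fin (q + 3), (2 * (((q + 3 : ℕ) : ℝ) - 1 - a)) • f a)
      (∑ a : Fin (q + 3), (2 * (((q + 3 : ℕ) : ℝ) - 1 - a)) • -f a.rev)
      (-f (Fin.last (q + 2))) (f (Fin.last (q + 2))) := by
  subst hpos hhalf
  have h01 : (0 : Fin (q + 3)) ≠ 1 := by simp
  have hdiag : ∀ x y : Fin n → ℝ, diagForm (fun _ => -1 / 2) x y = -1 / 2 * (x ⬝ᵥ y) := by
    intro x y
    simp only [diagForm, dotProduct, Finset.mul_sum, mul_assoc]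
  have hval : ∀ x : Fin n → ℝ, 4 * diagForm (fun _ => -1 / 2) x ρ /
      diagForm (fun _ => -1 / 2) (f 0 + f 1) (f 0 + f 1) = 2 * (x ⬝ᵥ ρ) := fun x => by
    rw [hdiag, hdiag,
      dotProduct_self_of_mem_symm_rootsD hf (Or.inl (add_mem_rootsD f h01))]
    ring
  have hg := hf.neg_rev
  have hrev0 : Fin.rev (0 : Fin (q + 3)) = Fin.last (q + 2) := by simp
  constructor
  · exact Set.iUnion_const _
  · exact fun _ => isUniqueMaximal_rootsD hf
  · intro x
    rw [hval, symm, Set.mem_ofPred_eq]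
    constructor
    · rintro (⟨⟨a, b, hab, rfl | rfl⟩ | ⟨a, b, hab, h | h⟩, h0⟩ | ⟨⟨a, b, hab, rfl | rfl⟩, h0⟩)
      · rw [add_dotProduct, hρ, hρ] at h0; norm_num at h0
      · rw [sub_dotProduct, hρ, hρ] at h0; norm_num at h0
      · refine ⟨b.rev, a.rev, Fin.rev_lt_rev.2 hab, Or.inl ?_⟩
        simp only [Fin.rev_rev]
        rw [neg_eq_iff_eq_neg.1 h]; abel
      · obtain rfl : x = -(f a - f b) := by rw [← h, neg_neg]
        rw [neg_dotProduct, sub_dotProduct, hρ, hρ] at h0; norm_num at h0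
      · rw [add_dotProduct, hρ, hρ] at h0; norm_num at h0
      · refine ⟨b.rev, a.rev, Fin.rev_lt_rev.2 hab, Or.inr ?_⟩
        simp only [Fin.rev_rev]; abel
    · rintro ⟨a, b, hab, rfl | rfl⟩
      · refine Or.inl ⟨Or.inr ⟨b.rev, a.rev, Fin.rev_lt_rev.2 hab, Or.inl (by simp [add_comm])⟩, ?_⟩
        rw [add_dotProduct, neg_dotProduct, neg_dotProduct, hρ, hρ]; norm_num
      · refine Or.inr ⟨⟨b.rev, a.rev, Fin.rev_lt_rev.2 hab, Or.inr (neg_sub_neg _ _)⟩, ?_⟩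
        rw [sub_dotProduct, neg_dotProduct, neg_dotProduct, hρ, hρ]; norm_num
  · intro j
    have := isUniqueMaximal_rootsD hg
    rwa [symm_rootsD_neg_rev, hrev0] at this
  · exact finsum_rootsD hf
  · exact finsum_rootsD hg
  · exact ⟨_, Or.inr rfl⟩
  · intro α hα
    have := add_notMem_weightsD hg hα
    rwa [weightsD_neg_rev, hrev0] at this
  · intro y hy hne
    rw [← weightsD_neg_rev] at hy ⊢
    exact exists_add_mem_weightsD _ hy (by rwa [hrev0])
  · refine ⟨⟨_, Or.inl rfl⟩, ?_⟩
    rw [hval, hρ]; norm_num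
  · rintro _ ⟨a, b, hab, rfl | rfl⟩ hα
    · rw [hval, sub_dotProduct, add_dotProduct, hρ, hρ, hρ]; norm_num
    -- For a < b the vector f_last - f_a + f_b has squared length 3, or 5 if b is last, so it is not
    -- a weight.
    · have h1 := dotProduct_self_of_mem_weightsD hf hα
      simp only [sub_dotProduct, dotProduct_sub, hf _ _, hab.ne, hab.ne',
        (hab.trans_le (Fin.le_last b)).ne, (hab.trans_le (Fin.le_last b)).ne', if_true,
        if_false] at h1
      split_ifs at h1 <;> norm_num at h1
  · intro y hy h0 hne
    rw [hval] at h0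
    obtain ⟨a, rfl | rfl⟩ := hy
    · have ha : a ≠ Fin.last (q + 2) := fun h => hne (by rw [h])
      refine ⟨_, sub_mem_rootsD f (Fin.lt_last_iff_ne_last.2 ha), ⟨Fin.last (q + 2), Or.inl (by abel)⟩, ?_⟩
      rw [hval, sub_sub_cancel, hρ]; norm_num
    · rw [neg_dotProduct, hρ] at h0; norm_num at h0

/-- In the coordinates u_a = f_a · ν, NS-dominance makes u decreasing with u_a + u_b ≤ 0 for a ≠ b,
and the flow adds M/2 to every u_a. Parseval expresses all inner products through u. -/
theorem spectralFlow_D {ρ : Fin n → ℝ} (hf : DotOrthonormal f) (hρ : ∀ a, f a ⬝ᵥ ρ = 1 / 2)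
    (hparseval : ∀ x y : Fin n → ℝ, x ⬝ᵥ y = ∑ a, (f a ⬝ᵥ x) * (f a ⬝ᵥ y))
    (k : ℝ) (ν : Fin n → ℝ) :
    SpectralFlow (s := 1) (fun _ => -1 / 2) 0 ρ (2 - ((q + 3 : ℕ) : ℝ))
      (fun k => (k + 1 / 2) * (k + (3 - ((q + 3 : ℕ) : ℝ)) / 2))
      (rootsD f) (rootsD fun a => -f a.rev) (fun _ => f 0 + f 1)
      (fun _ => -f (Fin.last (q + 2)) + -f (Fin.rev 1))
      (∑ a : Fin (q + 3), (2 * (((q + 3 : ℕ) : ℝ) - 1 - a)) • f a)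
      (∑ a : Fin (q + 3), (2 * (((q + 3 : ℕ) : ℝ) - 1 - a)) • -f a.rev)
      (-f (Fin.last (q + 2))) (f (Fin.last (q + 2))) k ν := by
  have h01 : (0 : Fin (q + 3)) ≠ 1 := by simp
  have hg := hf.neg_rev
  have hdiag : ∀ x y : Fin n → ℝ, diagForm (fun _ => -1 / 2) x y = -1 / 2 * (x ⬝ᵥ y) := by
    intro x y
    simp only [diagForm, dotProduct, Finset.mul_sum, mul_assoc]
  have hcor : ∀ x α : Fin n → ℝ, α ∈ symm (rootsD f) →
      2 * diagForm (fun _ => -1 / 2) x α / diagForm (fun _ => -1 / 2) α α = α ⬝ᵥ x := by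
    intro x α hα
    rw [hdiag, hdiag, dotProduct_self_of_mem_symm_rootsD hf hα, dotProduct_comm]
    ring
  intro M hM h1 h2
  have hsymm : ∀ α ∈ rootsD (fun a => -f a.rev), α ∈ symm (rootsD f) := fun α hα => by
    rw [← symm_rootsD_neg_rev]; exact Or.inl hα
  have hθN : -f (Fin.last (q + 2)) + -f (Fin.rev 1) ∈ rootsD (fun a => -f a.rev) := by
    have := add_mem_rootsD (fun a : Fin (q + 3) => -f a.rev) h01
    simpa using this
  have h2 := h2 0
  have hM := hM 0
  simp only [hdiag, dotProduct_self_of_mem_symm_rootsD hf (Or.inl (add_mem_rootsD f h01))] at hM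
  set u : Fin (q + 3) → ℝ := fun a => f a ⬝ᵥ ν with hu
  have hu' : ∀ a, f a ⬝ᵥ ν = u a := fun _ => rfl
  rw [hcor _ _ (hsymm _ hθN), add_dotProduct, neg_dotProduct, neg_dotProduct, hu', hu'] at h2
  have hsub : ∀ a b, a < b → ∃ c : ℕ, u a - u b = c := fun a b hab => by
    have hmem : f a - f b ∈ rootsD (fun a => -f a.rev) :=
      ⟨b.rev, a.rev, Fin.rev_lt_rev.2 hab, Or.inr (by simp only [Fin.rev_rev]; abel)⟩
    obtain ⟨c, hc⟩ := h1 _ hmem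
    rw [hcor _ _ (hsymm _ hmem), sub_dotProduct] at hc
    exact ⟨c, hc⟩
  have hadd : ∀ a b, a < b → ∃ c : ℕ, -u a - u b = c := fun a b hab => by
    have hmem : -f a - f b ∈ rootsD (fun a => -f a.rev) :=
      ⟨b.rev, a.rev, Fin.rev_lt_rev.2 hab, Or.inl (by simp only [Fin.rev_rev]; abel)⟩
    obtain ⟨c, hc⟩ := h1 _ hmem
    rw [hcor _ _ (hsymm _ hmem), sub_dotProduct, neg_dotProduct] at hc
    exact ⟨c, hc⟩
  have hanti : ∀ a b, a ≤ b → u b ≤ u a := fun a b hab => by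
    rcases hab.eq_or_lt with rfl | h
    · rfl
    · obtain ⟨c, hc⟩ := hsub a b h
      have := Nat.cast_nonneg (α := ℝ) c
      linarith
  have hnew : ∀ a, f a ⬝ᵥ (ν + (M 0 : ℝ) • ρ) = u a + M 0 / 2 := fun a => by
    rw [dotProduct_add, dotProduct_smul, hρ, hu', smul_eq_mul]; ring
  refine ⟨?_, fun j => ?_, ?_⟩
  · rintro α hα
    rw [hcor _ _ (Or.inl hα)]
    obtain ⟨a, b, hab, rfl | rfl⟩ := hα
    · obtain ⟨c, hc⟩ := hadd a b hab
      have hb := hanti b _ (Fin.le_last b)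
      -- Since a < b, the index a is at most the last but one, so -u_a - u_b is bounded by the
      -- NS-highest coroot value.
      have ha := hanti a (Fin.rev 1) (by
        rw [Fin.le_def, Fin.val_rev]
        have := Fin.lt_def.1 hab
        have := b.2
        simp; omega)
      have hcM : c ≤ M 0 := by
        have : (c : ℝ) ≤ M 0 := by linarith
        exact_mod_cast this
      refine ⟨M 0 - c, ?_⟩
      rw [add_dotProduct, hnew, hnew, Nat.cast_sub hcM]
      linarith
    · obtain ⟨c, hc⟩ := hsub a b hab
      refine ⟨c, ?_⟩
      rw [sub_dotProduct, hnew, hnew]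
      linarith
  · obtain rfl : j = 0 := Subsingleton.elim _ _
    rw [hcor _ _ (Or.inl (add_mem_rootsD f h01)), add_dotProduct, hnew, hnew]
    obtain ⟨c, hc⟩ := hadd 0 1 (Fin.pos_of_ne_zero h01.symm)
    have := Nat.cast_nonneg (α := ℝ) c
    linarith
  · have hτ : ∀ a, f a ⬝ᵥ (∑ b : Fin (q + 3), (2 * (((q + 3 : ℕ) : ℝ) - 1 - b)) • f b) =
        2 * (((q + 3 : ℕ) : ℝ) - 1 - a) := fun a => by
      simp [dotProduct_sum, dotProduct_smul, hf _ _]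
    have hτN : ∀ a, f a ⬝ᵥ
        (∑ b : Fin (q + 3), (2 * (((q + 3 : ℕ) : ℝ) - 1 - b)) • -f b.rev) = -2 * a := fun a => by
      rw [← Equiv.sum_comp Fin.revPerm]
      simp only [Fin.revPerm_apply, Fin.rev_rev, dotProduct_sum, dotProduct_smul, dotProduct_neg,
        hf _ _, smul_eq_mul, mul_neg, mul_ite, mul_one, mul_zero, Finset.sum_neg_distrib,
        Finset.sum_ite_eq, Finset.mem_univ, if_true, Fin.val_rev]
      rw [Nat.cast_sub (by omega)]
      push_cast
      ring
    have hl : ∀ x, x ⬝ᵥ f (Fin.last (q + 2)) = f (Fin.last (q + 2)) ⬝ᵥ x := fun x =>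
      dotProduct_comm _ _
    have hsum : ∑ a : Fin (q + 3), (a : ℝ) = (q + 3) * (q + 2) / 2 := by
      have h := Finset.sum_range_id_mul_two (q + 3)
      rw [Fin.sum_univ_eq_sum_range (fun a => (a : ℝ)), ← Nat.cast_sum, eq_div_iff two_ne_zero]
      exact_mod_cast h
    -- The sum ∑ a·u_a enters `e1` and `e4` with the same coefficient -2 and cancels. What remains
    -- involves only ∑ u_a², ∑ u_a, u_last, k and q.
    have e1 : ν ⬝ᵥ (ν + ∑ b : Fin (q + 3), (2 * (((q + 3 : ℕ) : ℝ) - 1 - b)) • -f b.rev) =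
        ∑ a, u a ^ 2 - 2 * ∑ a : Fin (q + 3), a * u a := by
      rw [hparseval, Finset.mul_sum, ← Finset.sum_sub_distrib]
      refine Finset.sum_congr rfl fun a _ => ?_
      rw [dotProduct_add, hτN, hu']; ring
    have e2 : ν ⬝ᵥ ρ = (∑ a, u a) / 2 := by
      rw [hparseval, Finset.sum_div]
      refine Finset.sum_congr rfl fun a _ => ?_
      rw [hρ, hu']; ring
    have e3 : ρ ⬝ᵥ ρ = ((q : ℝ) + 3) / 4 := by
      rw [hparseval]
      simp only [hρ]
      simp; ring
    have e4 : (ν + (M 0 : ℝ) • ρ) ⬝ᵥ (ν + (M 0 : ℝ) • ρ +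
        (∑ b : Fin (q + 3), (2 * (((q + 3 : ℕ) : ℝ) - 1 - b)) • f b - (2 : ℝ) • ρ)) =
        ∑ a, u a ^ 2 + (M 0 + 2 * q + 3) * ∑ a, u a - 2 * ∑ a : Fin (q + 3), a * u a +
          (M 0 / 2 * (M 0 / 2 + 2 * q + 3)) * (q + 3) - M 0 * ((q + 3) * (q + 2) / 2) := by
      have : (q : ℝ) + 3 = ∑ a : Fin (q + 3), 1 := by simp
      rw [hparseval, ← hsum, this, Finset.mul_sum, Finset.mul_sum, Finset.mul_sum, Finset.mul_sum,
        ← Finset.sum_add_distrib, ← Finset.sum_sub_distrib, ← Finset.sum_add_distrib,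
        ← Finset.sum_sub_distrib]
      refine Finset.sum_congr rfl fun a _ => ?_
      rw [dotProduct_add _ (ν + _), dotProduct_sub, hnew, hτ, dotProduct_smul, hρ, smul_eq_mul]
      push_cast
      ring
    have hMk : (M 0 : ℝ) = -2 * k - 1 := by rw [← hM]; ring
    -- From M = -2k - 1 ≥ 0 one gets k ≤ -1/2, so the denominator is negative.
    have hpos : k + (2 - ((q : ℝ) + 3)) ≠ 0 := fun h => by
      have := Nat.cast_nonneg (α := ℝ) (M 0)
      have := Nat.cast_nonneg (α := ℝ) q
      linarith
    simp only [hdiag, e1, e2, e3, e4, neg_dotProduct, hl]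
    rw [dotProduct_self_of_mem_symm_rootsD hf (Or.inl (add_mem_rootsD f h01)),
      dotProduct_add _ (ν + _), dotProduct_sub, hnew, hτ, dotProduct_smul, hρ, hu', hMk]
    push_cast [Fin.val_last]
    field_simp
    ring

end TypeDRank

/-! ### The two choices of ρ_R for spo(2|2r), via signed bases. -/

/-- The basis `ε_a` with the last vector multiplied by `t`. -/
def signedBasis (q : ℕ) (t : ℝ) (a : Fin (q + 3)) : Fin (q + 3) → ℝ :=
  Pi.single a (if a = Fin.last (q + 2) then t else 1)

theorem signedBasis_of_ne {q : ℕ} (t : ℝ) {a : Fin (q + 3)} (h : a ≠ Fin.last (q + 2)) :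
    signedBasis q t a = e a := by simp [signedBasis, h, e]

theorem signedBasis_last_neg_one (q : ℕ) :
    signedBasis q (-1) (Fin.last (q + 2)) = -e (Fin.last (q + 2)) := by
  simp [signedBasis, e, Pi.single_neg]

theorem signedBasis_one (q : ℕ) : signedBasis q 1 = e := by
  ext1 a; simp [signedBasis, e]

theorem signedBasis_eq_or {q : ℕ} {t : ℝ} (ht : t = 1 ∨ t = -1) (a : Fin (q + 3)) :
    signedBasis q t a = e a ∨ signedBasis q t a = -e a := by
  by_cases h : a = Fin.last (q + 2)
  · rcases ht with rfl | rfl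
    · rw [signedBasis_one]; exact Or.inl rfl
    · rw [h, signedBasis_last_neg_one]; exact Or.inr rfl
  · exact Or.inl (signedBasis_of_ne t h)

theorem signedBasis_dotProduct (q : ℕ) (t : ℝ) (a : Fin (q + 3)) (x : Fin (q + 3) → ℝ) :
    signedBasis q t a ⬝ᵥ x = (if a = Fin.last (q + 2) then t else 1) * x a := by
  rw [signedBasis, single_dotProduct]

theorem dotOrthonormal_signedBasis (q : ℕ) {t : ℝ} (ht : t = 1 ∨ t = -1) :
    DotOrthonormal (signedBasis q t) := fun a b => by
  rw [signedBasis_dotProduct]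
  by_cases hab : a = b
  · subst hab
    rcases ht with rfl | rfl <;> simp only [signedBasis, Pi.single_eq_same] <;> split_ifs <;> norm_num
  · simp [signedBasis, hab]

theorem signedBasis_parseval (q : ℕ) {t : ℝ} (ht : t = 1 ∨ t = -1) (x y : Fin (q + 3) → ℝ) :
    x ⬝ᵥ y = ∑ a, (signedBasis q t a ⬝ᵥ x) * (signedBasis q t a ⬝ᵥ y) := by
  refine Finset.sum_congr rfl fun a _ => ?_
  rw [signedBasis_dotProduct, signedBasis_dotProduct]
  rcases ht with rfl | rfl <;> split_ifs <;> ring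

/-- Negating the last vector exchanges f_a + f_last with f_a - f_last. This is the diagram
automorphism swapping ω_r and ω_{r-1}, and it preserves Δ♮_+. -/
theorem posD_eq_rootsD (q : ℕ) {t : ℝ} (ht : t = 1 ∨ t = -1) :
    posD (q + 3) = rootsD (signedBasis q t) := by
  rcases ht with rfl | rfl
  · rw [signedBasis_one]; rfl
  · ext x
    refine exists_congr fun a => exists_congr fun b => and_congr_right fun hab => ?_
    rw [signedBasis_of_ne _ (hab.trans_le (Fin.le_last b)).ne]
    by_cases hb : b = Fin.last (q + 2)
    · rw [hb, signedBasis_last_neg_one, or_comm, sub_neg_eq_add, ← sub_eq_add_neg]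
    · rw [signedBasis_of_ne _ hb]

theorem halfWeights_eq_weightsD (q : ℕ) {t : ℝ} (ht : t = 1 ∨ t = -1) :
    {η | ∃ a : Fin (q + 3), η = e a ∨ η = -e a} = weightsD (signedBasis q t) := by
  ext x
  refine exists_congr fun a => ?_
  rcases signedBasis_eq_or ht a with h | h <;> rw [h]
  rw [neg_neg, or_comm]

theorem satisfiesMain_spo (q : ℕ) (hr : 3 ≤ q + 3) {t : ℝ} (ht : t = 1 ∨ t = -1)
    {ρ : Fin (q + 3) → ℝ} (hρ : ∀ a, signedBasis q t a ⬝ᵥ ρ = 1 / 2) :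
    SatisfiesMain (Superalgebra.spo (q + 3) hr).data (0 : Fin 1) ρ :=
  main_of_explicitData_mk
    (explicitData_D (dotOrthonormal_signedBasis q ht) (posD_eq_rootsD q ht)
      (halfWeights_eq_weightsD q ht) hρ)
    (spectralFlow_D (dotOrthonormal_signedBasis q ht) hρ (signedBasis_parseval q ht))

/-! ### Assembly of the four families. -/

theorem satisfiesMain (g : Superalgebra) (i : Fin g.data.s) (ρ : Fin g.data.n → ℝ)
    (h : (i, ρ) ∈ g.data.rhoR) : SatisfiesMain g.data i ρ := by
  cases g with
  | psl22 =>
    obtain ⟨rfl, rfl⟩ := Prod.mk.inj (show (i, ρ) = ((0 : Fin 1), (e 0 : Fin 1 → ℝ)) from h)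
    exact main_of_explicitData_mk explicitData_psl22 spectralFlow_psl22
  | spo r hr =>
    obtain ⟨q, rfl⟩ : ∃ q, r = q + 3 := ⟨r - 3, by omega⟩
    rcases h with h | h
    · obtain ⟨rfl, rfl⟩ := Prod.mk.inj h
      refine satisfiesMain_spo q hr (t := 1) (Or.inl rfl) fun a => ?_
      rw [signedBasis_dotProduct]; simp
    · obtain ⟨rfl, rfl⟩ := Prod.mk.inj h
      -- The last coordinate of ω_{r-1} is -1/2, and the sign t = -1 restores the value 1/2.
      refine satisfiesMain_spo q hr (t := -1) (Or.inr rfl) fun a => ?_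
      rw [signedBasis_dotProduct]
      change _ * ((1 / 2 : ℝ) - (e (Fin.last (q + 2)) : Fin (q + 3) → ℝ) a) = 1 / 2
      by_cases ha : a = Fin.last (q + 2)
      · rw [if_pos ha, ha]; norm_num [e]
      · rw [if_neg ha]; simp [e, ha]
  | D21 m n hm hn hmn =>
    have hm' : (0 : ℝ) < m := by exact_mod_cast hm
    have hn' : (0 : ℝ) < n := by exact_mod_cast hn
    have hp : -(n : ℝ) / (2 * (m + n)) < 0 := div_neg_of_neg_of_pos (by linarith) (by positivity)
    have hq : -(m : ℝ) / (2 * (m + n)) < 0 := div_neg_of_neg_of_pos (by linarith) (by positivity)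
    have hpq : -(n : ℝ) / (2 * (m + n)) + -(m : ℝ) / (2 * (m + n)) = -1 / 2 := by
      field_simp; ring
    have hpoly : (fun k : ℝ => (k + (m : ℝ) / (m + n)) * (k + n / (m + n))) =
        fun k => (k - 2 * (-(n : ℝ) / (2 * (m + n)))) * (k - 2 * (-(m : ℝ) / (2 * (m + n)))) := by
      ext k; field_simp; ring
    rcases h with h | h
    · obtain ⟨rfl, rfl⟩ := Prod.mk.inj h
      exact main_of_explicitData_mk (explicitData_D21_zero _ _ hp)
        (hpoly ▸ spectralFlow_D21_zero _ _ hp hq hpq)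
    · obtain ⟨rfl, rfl⟩ := Prod.mk.inj h
      exact main_of_explicitData_mk (explicitData_D21_one _ _ hq)
        (hpoly ▸ spectralFlow_D21_one _ _ hp hq hpq)
  | F4 =>
    obtain ⟨rfl, rfl⟩ := Prod.mk.inj (show (i, ρ) = ((0 : Fin 1), (e 0 : Fin 3 → ℝ)) from h)
    exact main_of_explicitData_mk explicitData_F4 spectralFlow_F4

end MinimalW

theorem mainTheorem5 (g : MinimalW.Superalgebra) (k : ℝ)
    (hk : ∀ j, ∃ N : ℕ, g.data.M j k = N)
    (i : Fin g.data.s) (ρR : Fin g.data.n → ℝ) (hρR : (i, ρR) ∈ g.data.rhoR)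
    (ν : Fin g.data.n → ℝ) (hν : ν ∈ g.data.PNS i ρR k) :
    ν + g.data.M i k • ρR ∈ g.data.PR k ∧
    g.data.ANS i ρR k ν
        + 2 / g.data.form (g.data.theta i) (g.data.theta i) * g.data.form ν ρR
        + 1 / g.data.form (g.data.theta i) (g.data.theta i) * g.data.M i k * g.data.form ρR ρR
      = g.data.AR i ρR k (ν + g.data.M i k • ρR) :=
  MinimalW.satisfiesMain g i ρR hρR k hk ν hν
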